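/- Let $T>0$, $a<b$, and let $(\Omega,\mathcal F_T,\mathbb F,\mathbb P)$ be a filtered probability space over $[0,T]$. Let $E$ be the space of absolutely continuous $f:[a,b]\to\mathbb R$ with $f(a)=0$ and $\int_a^b|f'|^2dx<\infty$, let $V\subset E$ be a subspace of finite dimension $d\ge 1$ with basis $\lambda_1,\dots,\lambda_d$, write $\lambda(x)=(\lambda_1(x),\dots,\lambda_d(x))^\top$, and let $$r_t(x)=\phi_t(x)+\sum_{k=1}^d Z^k_t\lambda_k(x),\qquad X_t(x)=r_t(x)+\varepsilon_t(x),\qquad 0\le t\le T,\ x\in[a,b],$$ with $\phi$ known (deterministic), $Z=(Z^1,\dots,Z^d)^\top$ a process and $\varepsilon$ a random error field. For $n,N\in\mathbb N$ take the equidistant grids $t_i=(i-1)\rho(n)$, $1\le i\le\bar n$, and $x_j=a+(j-1)\delta(N)$, $1\le j\le\bar N$, with $\rho(n)=T/(\bar n-1)$, $\delta(N)=(b-a)/(\bar N-1)$, $\bar n,\bar N\ge2$, where $\bar n=\bar n(n)\to\infty$ as $n\to\infty$ and $\bar N=\bar N(N)\to\infty$ as $N\to\infty$. Put $\mathbb X=(X_{t_i}(x_j)-\phi_{t_i}(x_j))_{i,j}\in\mathbb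 M_{\bar n\times\bar N}$ and $C_{nN}=\min\{\delta(N)^{-1/2},\rho(n)^{-1/2}\}$. Assume: (D1) each $Z^j$ is a continuous Brownian semimartingale with $\mathbb E|Z^j_t|^4<\infty$ for all $t$; $\rho(n)\sum_{i=1}^{\bar n}Z_{t_i}Z_{t_i}^\top\to\Sigma_Z:=\big(\int_0^TZ^i_sZ^j_s\,ds\big)_{i,j}$ in probability as $n\to\infty$; and $\Sigma_Z$ is a.s. positive definite. (D2) $\sup_{N,j}\|\lambda(x_j)\|<\infty$; $\delta(N)\sum_{j=1}^{\bar N}\lambda(x_j)\lambda(x_j)^\top\to\Sigma_\lambda:=\big(\int_a^b\lambda_i\lambda_j\,dx\big)_{i,j}$ in Hilbert–Schmidt norm as $N\to\infty$; and $\Sigma_\lambda$ is positive definite. (D3) $\mathbb E\varepsilon_{t_i}(x_j)=0$ and $\mathbb E\sup_{i,j}|\varepsilon_{t_i}(x_j)|^8<\infty$ for all $n,N$; with $\gamma_N(s,t)=\delta(N)\,\mathbb E\sum_{\ell}\varepsilon_s(x_\ell)\varepsilon_t(x_\ell)$, the following are bounded uniformly in $n,N$ (and, where they occur free, in the indices $i,j$):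 $\gamma_N(t_i,t_i)$; $\ \rho(n)\sum_{i,j}|\gamma_N(t_i,t_j)|$; $\ \delta(N)\sum_{\ell,m}\sup_i|\mathbb E\varepsilon_{t_i}(x_m)\varepsilon_{t_i}(x_\ell)|$; $\ \delta(N)\rho(n)\sum_{i,j}\sum_{\ell,m}|\mathbb E\varepsilon_{t_i}(x_\ell)\varepsilon_{t_j}(x_m)|$; $\ \mathbb E\big|\delta(N)^{1/2}\sum_\ell[\varepsilon_{t_i}(x_\ell)\varepsilon_{t_j}(x_\ell)-\mathbb E\varepsilon_{t_i}(x_\ell)\varepsilon_{t_j}(x_\ell)]\big|^4$. Moreover $\varepsilon$ and $Z$ are independent. (D4) $\sup_{n,N,s}\mathbb E\big\|\sqrt{\rho(n)\delta(N)}\sum_{i,j}Z_{t_i}[\varepsilon_{t_i}(x_j)\varepsilon_{t_s}(x_j)-\mathbb E\varepsilon_{t_i}(x_j)\varepsilon_{t_s}(x_j)]\big\|^2<\infty$ and $\sup_{n,N}\mathbb E\big|\sqrt{\rho(n)\delta(N)}\sum_{i,j}Z_{t_i}^\top\lambda(x_j)\varepsilon_{t_i}(x_j)\big|^2<\infty$.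 Assume also that the $d$ eigenvalues of $\Sigma_\lambda\Sigma_Z$ are almost surely distinct. For $1\le k<\min\{\bar n,\bar N\}$ let $\hat Y(k)\in\mathbb M_{\bar n\times k}$ satisfy $\rho(n)\hat Y(k)^\top\hat Y(k)=I_k$, its $j$-th column being an eigenvector of $\mathbb X\mathbb X^\top$ for the $j$-th largest eigenvalue (any choice), and put $$V(k,\hat Y(k))=\min_{g\in\mathbb M_{\bar N\times k}}\rho(n)\delta(N)\sum_{i=1}^{\bar n}\sum_{j=1}^{\bar N}\Big(\mathbb X_{ij}-\sum_{r=1}^k g_{jr}\hat Y_{ir}(k)\Big)^2,\qquad PC(k)=V(k,\hat Y(k))+k\,q(n,N),$$ where $q(n,N)$ is a deterministic penalty. Let $k_{\max}\ge d$ be a fixed integer and $\hat d\in\arg\min_{1\le k\le k_{\max}}PC(k)$ (any minimizer). If $q(n,N)\to0$ and $C_{nN}\,q(n,N)\to\infty$ as $n,N\to\infty$ jointly, then $$\lim_{n,N\to\infty}\mathbb P[\hat d=\dim V]=1 .$$ -/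

import Mathlib

open MeasureTheory ProbabilityTheory Filter Topology Matrix
open scoped ENNReal NNReal

namespace FactorSPDE

noncomputable section

/-! ### State space and sampling grids -/

/-- Absolutely continuous functions `f : [a,b] → ℝ` with `f a = 0` and square-integrable
derivative: those of the form `f x = ∫ y in a..x, g y` with `g ∈ L²([a,b])`. -/
def stateSpace (a b : ℝ) : Submodule ℝ (Set.Icc a b → ℝ) where
  carrier := {f | ∃ g : ℝ → ℝ, MemLp g 2 (volume.restrict (Set.Icc a b)) ∧
    ∀ x : Set.Icc a b, f x = ∫ y in a..(x : ℝ), g y}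
  zero_mem' := ⟨0, MemLp.zero, fun x => by simp⟩
  add_mem' := by
    have key : ∀ g : ℝ → ℝ, MemLp g 2 (volume.restrict (Set.Icc a b)) →
        ∀ x : Set.Icc a b, IntervalIntegrable g volume a x := by
      intro g hg x
      have h1 : IntegrableOn g (Set.Icc a b) := hg.integrable (by norm_num)
      rw [intervalIntegrable_iff_integrableOn_Icc_of_le x.2.1]
      exact h1.mono_set (Set.Icc_subset_Icc le_rfl x.2.2)
    rintro f₁ f₂ ⟨g₁, h₁, e₁⟩ ⟨g₂, h₂, e₂⟩
    refine ⟨g₁ + g₂, h₁.add h₂, fun x => ?_⟩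
    have := intervalIntegral.integral_add (key g₁ h₁ x) (key g₂ h₂ x)
    simp [e₁ x, e₂ x, this]
  smul_mem' := by
    rintro c f ⟨g, h, e⟩
    exact ⟨c • g, h.const_smul c, fun x => by simp [e x]⟩

/-- Mesh of the equidistant grid with `m` points (endpoints included) on `[a,b]`. -/
def mesh (a b : ℝ) (m : ℕ) : ℝ := (b - a) / ((m : ℝ) - 1)

lemma grid_mem {a b : ℝ} (hab : a ≤ b) (m : ℕ) (i : Fin m) :
    a + (i : ℝ) * mesh a b m ∈ Set.Icc a b := by
  have hi : (i : ℝ) ≤ (m : ℝ) - 1 := by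
    have : ((i : ℕ) : ℝ) + 1 ≤ (m : ℝ) := by exact_mod_cast i.2
    linarith
  have h0 : (0 : ℝ) ≤ (i : ℝ) := Nat.cast_nonneg _
  have hba : 0 ≤ b - a := sub_nonneg.2 hab
  have hm : 0 ≤ (m : ℝ) - 1 := h0.trans hi
  have hmesh : 0 ≤ mesh a b m := div_nonneg hba hm
  refine ⟨by nlinarith [mul_nonneg h0 hmesh], ?_⟩
  have h1 : (i : ℝ) * mesh a b m ≤ ((m : ℝ) - 1) * mesh a b m :=
    mul_le_mul_of_nonneg_right hi hmesh
  have h2 : ((m : ℝ) - 1) * mesh a b m ≤ b - a := by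
    unfold mesh
    rcases hm.eq_or_lt with h | h
    · rw [← h]; simpa using hba
    · rw [mul_div_cancel₀ _ h.ne']
  linarith

/-- The `i`-th point (`i = 0, …, m - 1`) of the equidistant grid with `m` points on `[a,b]`. -/
def gridPoint {a b : ℝ} (hab : a ≤ b) (m : ℕ) (i : Fin m) : Set.Icc a b :=
  ⟨a + (i : ℝ) * mesh a b m, grid_mem hab m i⟩

/-- Lebesgue measure on the interval `[a,b]`. -/
def leb (a b : ℝ) : Measure (Set.Icc a b) := Measure.comap Subtype.val volume

/-! ### Continuous Brownian semimartingales -/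

section Semimartingale

variable {Ω : Type*} {mΩ : MeasurableSpace Ω} {T : ℝ}

/-- `W` is an `m`-dimensional standard Brownian motion on `[0,T]` with respect to `𝓕`. -/
structure IsBrownianMotion (P : Measure Ω) (𝓕 : Filtration (Set.Icc (0 : ℝ) T) mΩ)
    {m : ℕ} (W : Fin m → Set.Icc (0 : ℝ) T → Ω → ℝ) : Prop where
  adapted : ∀ j t, Measurable[𝓕 t] (W j t)
  zero : ∀ j, ∀ t : Set.Icc (0 : ℝ) T, (t : ℝ) = 0 → ∀ᵐ ω ∂P, W j t ω = 0
  continuous : ∀ j, ∀ᵐ ω ∂P, Continuous fun t => W j t ω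
  gaussian : ∀ j, ∀ s t : Set.Icc (0 : ℝ) T, s ≤ t →
    P.map (fun ω => W j t ω - W j s ω) = gaussianReal 0 (Real.toNNReal ((t : ℝ) - s))
  indep_components : ∀ s t, s ≤ t → iIndepFun (fun j ω => W j t ω - W j s ω) P
  indep_past : ∀ s t, s ≤ t →
    Indep (𝓕 s) (⨆ j, MeasurableSpace.comap (fun ω => W j t ω - W j s ω) inferInstance) P

/-- Simple predictable integrands `∑ i < len, ξ i · 1_{(τ i, τ (i+1)]}` with `ξ i` bounded and
`𝓕 (τ i)`-measurable. -/
structure SimpleIntegrand (𝓕 : Filtration (Set.Icc (0 : ℝ) T) mΩ) where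
  len : ℕ
  τ : ℕ → Set.Icc (0 : ℝ) T
  mono : Monotone τ
  ξ : ℕ → Ω → ℝ
  meas : ∀ i, Measurable[𝓕 (τ i)] (ξ i)
  bdd : ∃ C : ℝ, ∀ i ω, |ξ i ω| ≤ C

/-- The process defined by a simple integrand. -/
def SimpleIntegrand.eval {𝓕 : Filtration (Set.Icc (0 : ℝ) T) mΩ} (h : SimpleIntegrand 𝓕)
    (s : Set.Icc (0 : ℝ) T) (ω : Ω) : ℝ :=
  ∑ i ∈ Finset.range h.len, (Set.Ioc (h.τ i) (h.τ (i + 1))).indicator (fun _ => h.ξ i ω) s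

/-- The elementary stochastic integral of a simple integrand. -/
def SimpleIntegrand.integral {𝓕 : Filtration (Set.Icc (0 : ℝ) T) mΩ} (h : SimpleIntegrand 𝓕)
    (W : Set.Icc (0 : ℝ) T → Ω → ℝ) (t : Set.Icc (0 : ℝ) T) (ω : Ω) : ℝ :=
  ∑ i ∈ Finset.range h.len, h.ξ i ω * (W (min t (h.τ (i + 1))) ω - W (min t (h.τ i)) ω)

/-- `I` is (a version of) the Itô integral process `∫₀ᵗ H dW`, for a progressive `H` with
`∫₀ᵀ H² ds < ∞` a.s.: a continuous process that is the uniform limit in probability of elementary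
integrals of simple integrands approximating `H` in `L²([0,T])` in probability. -/
structure IsItoIntegral (P : Measure Ω) (𝓕 : Filtration (Set.Icc (0 : ℝ) T) mΩ)
    (H W I : Set.Icc (0 : ℝ) T → Ω → ℝ) : Prop where
  progressive : IsProgressive 𝓕 H
  sq_integrable : ∀ᵐ ω ∂P, ∫⁻ s, ‖H s ω‖ₑ ^ 2 ∂(leb 0 T) < ∞
  continuous : ∀ᵐ ω ∂P, Continuous fun t => I t ω
  approx : ∃ h : ℕ → SimpleIntegrand 𝓕,
    (∀ η : ℝ≥0∞, 0 < η →
      Tendsto (fun n => P {ω | η ≤ ∫⁻ s, ‖(h n).eval s ω - H s ω‖ₑ ^ 2 ∂(leb 0 T)}) atTop (𝓝 0)) ∧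
    (∀ η : ℝ, 0 < η →
      Tendsto (fun n => P {ω | ∃ t, η ≤ |(h n).integral W t ω - I t ω|}) atTop (𝓝 0))

/-- `q`-integrable continuous Brownian semimartingales
`Z t = Z 0 + ∫₀ᵗ b ds + ∑ j, ∫₀ᵗ σ j dW j` on `[0,T]`. -/
structure IsBrownianSemimartingale (P : Measure Ω) (𝓕 : Filtration (Set.Icc (0 : ℝ) T) mΩ)
    (q : ℝ≥0∞) (Z : Set.Icc (0 : ℝ) T → Ω → ℝ) : Prop where
  adapted : ∀ t, Measurable[𝓕 t] (Z t)
  continuous : ∀ᵐ ω ∂P, Continuous fun t => Z t ω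
  memLp : ∀ t, MemLp (Z t) q P
  decomposition : ∃ (m : ℕ) (W : Fin m → Set.Icc (0 : ℝ) T → Ω → ℝ)
    (drift : Set.Icc (0 : ℝ) T → Ω → ℝ) (σ I : Fin m → Set.Icc (0 : ℝ) T → Ω → ℝ),
    IsBrownianMotion P 𝓕 W ∧ IsProgressive 𝓕 drift ∧
    (∀ᵐ ω ∂P, Integrable (fun s => drift s ω) (leb 0 T)) ∧
    (∀ j, IsItoIntegral P 𝓕 (σ j) (W j) (I j)) ∧
    ∀ t₀ : Set.Icc (0 : ℝ) T, (t₀ : ℝ) = 0 →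
      ∀ᵐ ω ∂P, ∀ t, Z t ω = Z t₀ ω + (∫ s in Set.Iic t, drift s ω ∂(leb 0 T)) + ∑ j, I j t ω

end Semimartingale

/-! ### Limit matrices and assumptions -/

/-- Hilbert–Schmidt norm of a matrix. -/
def hsNorm {m k : ℕ} (A : Matrix (Fin m) (Fin k) ℝ) : ℝ := Real.sqrt (∑ i, ∑ j, A i j ^ 2)

/-- A `d × d` matrix with `d` distinct (real) eigenvalues. -/
def HasDistinctEigenvalues {d : ℕ} (A : Matrix (Fin d) (Fin d) ℝ) : Prop :=
  {μ : ℝ | Module.End.HasEigenvalue (Matrix.toLin' A) μ}.ncard = d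

section Assumptions

variable {Ω : Type*} {mΩ : MeasurableSpace Ω} {T a b : ℝ} {d : ℕ} {nbar Nbar : ℕ → ℕ}

/-- `Σ_Z`, the random Gram matrix of the factors in `L²([0,T])`. -/
def sigmaZ (Z : Fin d → Set.Icc (0 : ℝ) T → Ω → ℝ) (ω : Ω) : Matrix (Fin d) (Fin d) ℝ :=
  Matrix.of fun i j => ∫ s, Z i s ω * Z j s ω ∂(leb 0 T)

/-- `Σ_λ`, the Gram matrix of the loadings in `L²([a,b])`. -/
def sigmaLambda (lam : Fin d → Set.Icc a b → ℝ) : Matrix (Fin d) (Fin d) ℝ :=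
  Matrix.of fun i j => ∫ x, lam i x * lam j x ∂(leb a b)

/-- Assumption on the factors (`tm n` is the `n`-th time grid, `ρ n` its mesh). -/
structure FactorAssumption (P : Measure Ω) (𝓕 : Filtration (Set.Icc (0 : ℝ) T) mΩ)
    (tm : (n : ℕ) → Fin (nbar n) → Set.Icc (0 : ℝ) T) (ρ : ℕ → ℝ)
    (Z : Fin d → Set.Icc (0 : ℝ) T → Ω → ℝ) : Prop where
  semimartingale : ∀ j, IsBrownianSemimartingale P 𝓕 4 (Z j)
  tendsto : ∀ k l, TendstoInMeasure P
    (fun n ω => ρ n * ∑ i, Z k (tm n i) ω * Z l (tm n i) ω) atTop (fun ω => sigmaZ Z ω k l)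
  posDef : ∀ᵐ ω ∂P, (sigmaZ Z ω).PosDef

/-- Assumption on the loadings (`xs N` is the `N`-th space grid, `δ N` its mesh). -/
structure LoadingAssumption (xs : (N : ℕ) → Fin (Nbar N) → Set.Icc a b) (δ : ℕ → ℝ)
    (lam : Fin d → Set.Icc a b → ℝ) : Prop where
  bounded : ∃ C : ℝ, ∀ N j, ‖WithLp.toLp 2 (fun k => lam k (xs N j))‖ ≤ C
  tendsto : Tendsto (fun N => hsNorm (δ N • (∑ j, Matrix.of fun k l =>
    lam k (xs N j) * lam l (xs N j)) - sigmaLambda lam)) atTop (𝓝 0)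
  posDef : (sigmaLambda lam).PosDef

/-- `γ_N(s,t) = δ(N) 𝔼⟨ε_s, ε_t⟩`, the inner product being taken over the points of the
`N`-th space grid. -/
def gammaN (P : Measure Ω) (xs : (N : ℕ) → Fin (Nbar N) → Set.Icc a b) (δ : ℕ → ℝ)
    (ε : Set.Icc (0 : ℝ) T → Set.Icc a b → Ω → ℝ) (N : ℕ) (s t : Set.Icc (0 : ℝ) T) : ℝ :=
  δ N * ∫ ω, ∑ l, ε s (xs N l) ω * ε t (xs N l) ω ∂P

/-- Assumption on the space-time error `ε`. -/
structure NoiseAssumption (P : Measure Ω)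
    (tm : (n : ℕ) → Fin (nbar n) → Set.Icc (0 : ℝ) T) (ρ : ℕ → ℝ)
    (xs : (N : ℕ) → Fin (Nbar N) → Set.Icc a b) (δ : ℕ → ℝ)
    (Z : Fin d → Set.Icc (0 : ℝ) T → Ω → ℝ)
    (ε : Set.Icc (0 : ℝ) T → Set.Icc a b → Ω → ℝ) : Prop where
  measurable : ∀ t x, Measurable (ε t x)
  centered : ∀ n N i j, ∫ ω, ε (tm n i) (xs N j) ω ∂P = 0
  moment : ∀ n N, ∫⁻ ω, (⨆ i, ⨆ j, ‖ε (tm n i) (xs N j) ω‖ₑ ^ 8) ∂P < ∞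
  gamma_diag : ∃ M : ℝ, ∀ n N i, gammaN P xs δ ε N (tm n i) (tm n i) ≤ M
  gamma_sum : ∃ M : ℝ, ∀ n N,
    ρ n * ∑ i, ∑ j, |gammaN P xs δ ε N (tm n i) (tm n j)| ≤ M
  cross_section : ∃ M : ℝ, ∀ n N,
    δ N * ∑ l, ∑ m, (⨆ i, |∫ ω, ε (tm n i) (xs N m) ω * ε (tm n i) (xs N l) ω ∂P|) ≤ M
  total : ∃ M : ℝ, ∀ n N,
    δ N * ρ n * ∑ i, ∑ j, ∑ l, ∑ m,
      |∫ ω, ε (tm n i) (xs N l) ω * ε (tm n j) (xs N m) ω ∂P| ≤ M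
  fourth_moment : ∃ M : ℝ≥0, ∀ n N i j,
    ∫⁻ ω, ‖Real.sqrt (δ N) * ∑ l, (ε (tm n i) (xs N l) ω * ε (tm n j) (xs N l) ω
      - ∫ ω', ε (tm n i) (xs N l) ω' * ε (tm n j) (xs N l) ω' ∂P)‖ₑ ^ 4 ∂P ≤ M
  indep : IndepFun (fun ω (p : Set.Icc (0 : ℝ) T × Set.Icc a b) => ε p.1 p.2 ω)
    (fun ω (p : Fin d × Set.Icc (0 : ℝ) T) => Z p.1 p.2 ω) P

/-- Assumption on the mixed moments of factors, loadings and errors. -/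
structure MixedMomentAssumption (P : Measure Ω)
    (tm : (n : ℕ) → Fin (nbar n) → Set.Icc (0 : ℝ) T) (ρ : ℕ → ℝ)
    (xs : (N : ℕ) → Fin (Nbar N) → Set.Icc a b) (δ : ℕ → ℝ)
    (Z : Fin d → Set.Icc (0 : ℝ) T → Ω → ℝ) (lam : Fin d → Set.Icc a b → ℝ)
    (ε : Set.Icc (0 : ℝ) T → Set.Icc a b → Ω → ℝ) : Prop where
  factor_noise : ∃ M : ℝ≥0, ∀ n N s,
    ∫⁻ ω, ‖Real.sqrt (ρ n * δ N) • ∑ i, ∑ j,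
      (ε (tm n i) (xs N j) ω * ε (tm n s) (xs N j) ω
        - ∫ ω', ε (tm n i) (xs N j) ω' * ε (tm n s) (xs N j) ω' ∂P) •
          WithLp.toLp 2 (fun k => Z k (tm n i) ω)‖ₑ ^ 2 ∂P ≤ M
  factor_loading_noise : ∃ M : ℝ≥0, ∀ n N,
    ∫⁻ ω, ‖Real.sqrt (ρ n * δ N) * ∑ i, ∑ j,
      (∑ k, Z k (tm n i) ω * lam k (xs N j)) * ε (tm n i) (xs N j) ω‖ₑ ^ 2 ∂P ≤ M

end Assumptions

/-! ### The estimators -/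

lemma isHermitian_self_mul_transpose {m l : ℕ} (X : Matrix (Fin m) (Fin l) ℝ) :
    (X * Xᵀ).IsHermitian := by
  simpa [Matrix.conjTranspose_eq_transpose_of_trivial] using
    Matrix.isHermitian_mul_conjTranspose_self X

/-- The `j`-th largest eigenvalue (`j = 0, 1, …`, with multiplicity) of `X Xᵀ`. -/
def sortedEigenvalue {m l : ℕ} (X : Matrix (Fin m) (Fin l) ℝ) (j : ℕ) : ℝ :=
  if h : j < Fintype.card (Fin m) then (isHermitian_self_mul_transpose X).eigenvalues₀ ⟨j, h⟩ else 0

/-- `Y` is an estimator of `k` factors from the data `X`: `ρ Yᵀ Y = I`, and the `j`-th column of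
`Y` is an eigenvector of `X Xᵀ` for its `j`-th largest eigenvalue. -/
def IsFactorEstimator {m l k : ℕ} (ρ : ℝ) (X : Matrix (Fin m) (Fin l) ℝ)
    (Y : Matrix (Fin m) (Fin k) ℝ) : Prop :=
  ρ • (Yᵀ * Y) = 1 ∧
    ∀ j : Fin k, (X * Xᵀ) *ᵥ (fun i => Y i j) = sortedEigenvalue X j • fun i => Y i j

/-- `V(k, Y)`: the least-squares residual over all loadings `g` (the infimum is a minimum). -/
def residual {m l k : ℕ} (ρ δ : ℝ) (X : Matrix (Fin m) (Fin l) ℝ)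
    (Y : Matrix (Fin m) (Fin k) ℝ) : ℝ :=
  ⨅ g : Matrix (Fin l) (Fin k) ℝ, ρ * δ * ∑ i, ∑ j, (X i j - ∑ r, g j r * Y i r) ^ 2

/-- The information criterion `PC(k) = V(k, Y) + k q`. -/
def PC {m l k : ℕ} (ρ δ q : ℝ) (X : Matrix (Fin m) (Fin l) ℝ)
    (Y : Matrix (Fin m) (Fin k) ℝ) : ℝ :=
  residual ρ δ X Y + k * q

/-- The data matrix `X_{t_i}(x_j) - φ_{t_i}(x_j)`. -/
def dataMatrix {Ω τ χ : Type*} {m l : ℕ} (X : τ → χ → Ω → ℝ) (φ : τ → χ → ℝ)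
    (tm : Fin m → τ) (xs : Fin l → χ) (ω : Ω) : Matrix (Fin m) (Fin l) ℝ :=
  Matrix.of fun i j => X (tm i) (xs j) ω - φ (tm i) (xs j)

end

end FactorSPDE

namespace FactorSPDE

/-! ### Spectral bounds for Gram matrices -/

/-! With scores normalized by `ρ Yᵀ Y = 1`, least squares gives `V(k) = ρδ (|X|² - μ₀ - ... -
μ_{k-1})`, where `μ_r` are the sorted eigenvalues of `X Xᵀ` (`residual_eq`). Each further factor
thus gains `ρδ μ_r` and costs `q`, so every minimizer equals `d` once `ρδ μ_r > q` for `r < d` and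
`ρδ μ_r < q` for `r ≥ d` (`eq_of_PC_le`).

This gap comes from min-max arguments on `X = F Λᵀ + e`. Let `B` be the Hilbert–Schmidt norm of `ρδ
e eᵀ`. On the kernel of `Fᵀ`, of codimension at most `d`, only noise is seen, so `ρδ μ_d ≤ B`. On
the range of `F`, lower bounds `c` and `c'` for the Gram matrices of `F` and `Λ` yield `ρδ μ_{d-1} ≥
c c'/2 - B`.

Probability enters in two places. The mean of `B²` is `O(ρ + δ)`
(`NoiseAssumption.exists_lintegral_gram_le`), so `B` is of order at most `1/C`, and `C q → ∞` makes
it negligible against `q` by Markov's inequality. The Gram matrices converge to positive definite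
limits, so `c` and `c'` can be fixed outside an event of small probability, and `q → 0` falls below
`c c'`. -/

lemma sortedEigenvalue_antitone {m l : ℕ} (X : Matrix (Fin m) (Fin l) ℝ) {i j : ℕ}
    (hij : i ≤ j) (hj : j < m) : sortedEigenvalue X j ≤ sortedEigenvalue X i := by
  have hj' : j < Fintype.card (Fin m) := by simpa using hj
  have hi' : i < Fintype.card (Fin m) := hij.trans_lt hj'
  rw [sortedEigenvalue, sortedEigenvalue, dif_pos hj', dif_pos hi']
  exact (isHermitian_self_mul_transpose X).eigenvalues₀_antitone (by simpa using hij)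

/-- Parseval identities in an orthonormal eigenbasis of `X Xᵀ` sorted by eigenvalues. -/
lemma exists_sorted_eigenbasis {m l : ℕ} (X : Matrix (Fin m) (Fin l) ℝ) :
    ∃ v : Fin m → Fin m → ℝ, ∀ u : Fin m → ℝ,
      u ⬝ᵥ u = ∑ j, (v j ⬝ᵥ u) ^ 2 ∧
      (Xᵀ *ᵥ u) ⬝ᵥ (Xᵀ *ᵥ u) = ∑ j : Fin m, sortedEigenvalue X j * (v j ⬝ᵥ u) ^ 2 := by
  have hA := isHermitian_self_mul_transpose X
  -- `e` is the reindexing used to define `eigenvalues` from the sorted `eigenvalues₀`; composing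
  -- with the cast `c` lists the eigenbasis in decreasing order of eigenvalue.
  let e : Fin (Fintype.card (Fin m)) ≃ Fin m := Fintype.equivOfCardEq (Fintype.card_fin _)
  let c : Fin m ≃ Fin (Fintype.card (Fin m)) := finCongr (Fintype.card_fin m).symm
  let b := hA.eigenvectorBasis
  have hb : ∀ j : Fin m, (X * Xᵀ) *ᵥ (b (e (c j))).ofLp
      = sortedEigenvalue X j • (b (e (c j))).ofLp := by
    intro j
    rw [hA.mulVec_eigenvectorBasis]
    congr 1
    rw [sortedEigenvalue, dif_pos (by simp), Matrix.IsHermitian.eigenvalues]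
    congr 1
    simp only [e, c, Equiv.symm_apply_apply]
    rfl
  have inner_eq : ∀ (j : Fin m) (u : Fin m → ℝ),
      inner ℝ (b j) (WithLp.toLp 2 u) = (b j).ofLp ⬝ᵥ u := by
    intro j u
    simp [EuclideanSpace.inner_eq_star_dotProduct, dotProduct_comm]
  have inner_eq' : ∀ (j : Fin m) (u : Fin m → ℝ),
      inner ℝ (WithLp.toLp 2 u) (b j) = (b j).ofLp ⬝ᵥ u := by
    intro j u
    rw [real_inner_comm, inner_eq]
  have parseval : ∀ u w : Fin m → ℝ,
      u ⬝ᵥ w = ∑ j, ((b (e (c j))).ofLp ⬝ᵥ u) * ((b (e (c j))).ofLp ⬝ᵥ w) := by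
    intro u w
    have h := b.sum_inner_mul_inner (WithLp.toLp 2 u) (WithLp.toLp 2 w)
    simp only [inner_eq, inner_eq'] at h
    rw [EuclideanSpace.inner_eq_star_dotProduct] at h
    have h' := Equiv.sum_comp (c.trans e) fun j => ((b j).ofLp ⬝ᵥ u) * ((b j).ofLp ⬝ᵥ w)
    rw [h] at h'
    simpa [dotProduct_comm] using h'.symm
  refine ⟨fun j => (b (e (c j))).ofLp, fun u => ⟨?_, ?_⟩⟩
  · rw [parseval u u]; simp only [sq]
  · have h1 : (Xᵀ *ᵥ u) ⬝ᵥ (Xᵀ *ᵥ u) = u ⬝ᵥ ((X * Xᵀ) *ᵥ u) := by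
      rw [← Matrix.mulVec_mulVec, dotProduct_mulVec u, mulVec_transpose]
    rw [h1, parseval]
    refine Finset.sum_congr rfl fun j _ => ?_
    have h2 : (b (e (c j))).ofLp ⬝ᵥ ((X * Xᵀ) *ᵥ u)
        = sortedEigenvalue X j * ((b (e (c j))).ofLp ⬝ᵥ u) := by
      rw [dotProduct_mulVec, ← mulVec_transpose, Matrix.transpose_mul, Matrix.transpose_transpose,
        hb, smul_dotProduct, smul_eq_mul]
    rw [h2]; ring

/-- If `|Xᵀ u|² ≤ B |u|²` on the kernel of `d` linear forms, the `(d+1)`-st largest eigenvalue of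
`X Xᵀ` is at most `B`. -/
lemma sortedEigenvalue_le {m l d : ℕ} (X : Matrix (Fin m) (Fin l) ℝ)
    (F : Matrix (Fin m) (Fin d) ℝ) (hdm : d < m) {B : ℝ}
    (hB : ∀ u : Fin m → ℝ, Fᵀ *ᵥ u = 0 → (Xᵀ *ᵥ u) ⬝ᵥ (Xᵀ *ᵥ u) ≤ B * (u ⬝ᵥ u)) :
    sortedEigenvalue X d ≤ B := by
  obtain ⟨v, hv⟩ := exists_sorted_eigenbasis X
  -- The target has dimension `d + (m - d - 1) = m - 1`, so some nonzero `u` is killed by `Fᵀ` and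
  -- involves only the top `d + 1` eigenvectors.
  let f : (Fin m → ℝ) →ₗ[ℝ] (Fin d → ℝ) × (Fin (m - d - 1) → ℝ) :=
    (Matrix.mulVecLin Fᵀ).prod (Matrix.mulVecLin
      (Matrix.of fun j : Fin (m - d - 1) => v ⟨j + d + 1, by omega⟩))
  obtain ⟨u, hu, hu0⟩ := Submodule.exists_mem_ne_zero_of_ne_bot
    (LinearMap.ker_ne_bot_of_finrank_lt (f := f) (by simp; omega))
  have hfu : f u = 0 := hu
  have h1 : Fᵀ *ᵥ u = 0 := congrArg Prod.fst hfu
  have h2 : ∀ j : Fin m, d < j → v j ⬝ᵥ u = 0 := by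
    intro j hj
    have := congrFun (congrArg Prod.snd hfu) ⟨j - d - 1, by omega⟩
    have hj' : (⟨(j : ℕ) - d - 1 + d + 1, by omega⟩ : Fin m) = j := Fin.ext (by simp; omega)
    simpa [f, Matrix.mulVec, hj'] using this
  have hpos : 0 < u ⬝ᵥ u := by
    have := dotProduct_star_self_pos_iff.2 hu0
    simpa using this
  have key : sortedEigenvalue X d * (u ⬝ᵥ u) ≤ (Xᵀ *ᵥ u) ⬝ᵥ (Xᵀ *ᵥ u) := by
    rw [(hv u).1, (hv u).2, Finset.mul_sum]
    refine Finset.sum_le_sum fun j _ => ?_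
    rcases lt_or_ge d (j : ℕ) with h | h
    · simp [h2 j h]
    · exact mul_le_mul_of_nonneg_right (sortedEigenvalue_antitone X h hdm) (sq_nonneg _)
  exact le_of_mul_le_mul_right (key.trans (hB u h1)) hpos

/-- If `B |u|² ≤ |Xᵀ u|²` on the range of an injective map from `ℝᵈ`, `k < d`, the `(k+1)`-st largest
eigenvalue of `X Xᵀ` is at least `B`. -/
lemma le_sortedEigenvalue {m l d k : ℕ} (X : Matrix (Fin m) (Fin l) ℝ)
    (F : Matrix (Fin m) (Fin d) ℝ) (hkd : k < d) (hkm : k < m) {B : ℝ}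
    (hF : ∀ w : Fin d → ℝ, w ≠ 0 → 0 < (F *ᵥ w) ⬝ᵥ (F *ᵥ w))
    (hB : ∀ w : Fin d → ℝ, B * ((F *ᵥ w) ⬝ᵥ (F *ᵥ w)) ≤
      (Xᵀ *ᵥ (F *ᵥ w)) ⬝ᵥ (Xᵀ *ᵥ (F *ᵥ w))) :
    B ≤ sortedEigenvalue X k := by
  obtain ⟨v, hv⟩ := exists_sorted_eigenbasis X
  -- As `k < d`, some nonzero `w` has `F w` orthogonal to the top `k` eigenvectors.
  let f : (Fin d → ℝ) →ₗ[ℝ] (Fin k → ℝ) :=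
    (Matrix.mulVecLin (Matrix.of fun j : Fin k => v ⟨j, j.2.trans hkm⟩)) ∘ₗ Matrix.mulVecLin F
  obtain ⟨w, hw, hw0⟩ := Submodule.exists_mem_ne_zero_of_ne_bot
    (LinearMap.ker_ne_bot_of_finrank_lt (f := f) (by simpa using hkd))
  have hfw : f w = 0 := hw
  have h2 : ∀ j : Fin m, (j : ℕ) < k → v j ⬝ᵥ (F *ᵥ w) = 0 := by
    intro j hj
    have := congrFun hfw ⟨j, hj⟩
    simpa [f, Matrix.mulVec] using this
  have key : (Xᵀ *ᵥ (F *ᵥ w)) ⬝ᵥ (Xᵀ *ᵥ (F *ᵥ w)) ≤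
      sortedEigenvalue X k * ((F *ᵥ w) ⬝ᵥ (F *ᵥ w)) := by
    rw [(hv _).1, (hv _).2, Finset.mul_sum]
    refine Finset.sum_le_sum fun j _ => ?_
    rcases lt_or_ge (j : ℕ) k with h | h
    · simp [h2 j h]
    · exact mul_le_mul_of_nonneg_right (sortedEigenvalue_antitone X h j.2) (sq_nonneg _)
  exact le_of_mul_le_mul_right ((hB w).trans key) (hF w hw0)

lemma dotProduct_self_nonneg_real {ι : Type*} [Fintype ι] (u : ι → ℝ) : 0 ≤ u ⬝ᵥ u :=
  Finset.sum_nonneg fun i _ => mul_self_nonneg (u i)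

lemma sq_dotProduct_le {ι : Type*} [Fintype ι] (u w : ι → ℝ) :
    (u ⬝ᵥ w) ^ 2 ≤ (u ⬝ᵥ u) * (w ⬝ᵥ w) := by
  have := Finset.sum_mul_sq_le_sq_mul_sq Finset.univ u w
  simpa [dotProduct, sq] using this

/-- A quadratic form is bounded by the Hilbert–Schmidt norm. -/
lemma abs_quadForm_le {m : ℕ} (A : Matrix (Fin m) (Fin m) ℝ) {B : ℝ} (hB0 : 0 ≤ B)
    (hB : ∑ i, ∑ j, A i j ^ 2 ≤ B ^ 2) (u : Fin m → ℝ) :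
    |u ⬝ᵥ (A *ᵥ u)| ≤ B * (u ⬝ᵥ u) := by
  have hu := dotProduct_self_nonneg_real u
  have h1 : (A *ᵥ u) ⬝ᵥ (A *ᵥ u) ≤ B ^ 2 * (u ⬝ᵥ u) := by
    calc (A *ᵥ u) ⬝ᵥ (A *ᵥ u) = ∑ i, (A i ⬝ᵥ u) ^ 2 := by simp [dotProduct, mulVec, sq]
      _ ≤ ∑ i, (A i ⬝ᵥ A i) * (u ⬝ᵥ u) := Finset.sum_le_sum fun i _ => sq_dotProduct_le _ _
      _ = (∑ i, ∑ j, A i j ^ 2) * (u ⬝ᵥ u) := by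
        rw [← Finset.sum_mul]; simp [dotProduct, sq]
      _ ≤ _ := mul_le_mul_of_nonneg_right hB hu
  refine abs_le_of_sq_le_sq ?_ (mul_nonneg hB0 hu)
  calc _ ≤ (u ⬝ᵥ u) * ((A *ᵥ u) ⬝ᵥ (A *ᵥ u)) := sq_dotProduct_le _ _
    _ ≤ (u ⬝ᵥ u) * (B ^ 2 * (u ⬝ᵥ u)) := mul_le_mul_of_nonneg_left h1 hu
    _ = _ := by ring

lemma transpose_mulVec_dotProduct_self {m l : ℕ} (e : Matrix (Fin m) (Fin l) ℝ) (u : Fin m → ℝ) :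
    (eᵀ *ᵥ u) ⬝ᵥ (eᵀ *ᵥ u) = u ⬝ᵥ ((e * eᵀ) *ᵥ u) := by
  rw [← Matrix.mulVec_mulVec, dotProduct_mulVec u, mulVec_transpose]

/-! ### Deterministic analysis of the factor model `X = F Λᵀ + e`. -/

section FactorModel

variable {m l d : ℕ} {X e : Matrix (Fin m) (Fin l) ℝ} {F : Matrix (Fin m) (Fin d) ℝ}
  {Λ : Matrix (Fin l) (Fin d) ℝ} {ρ δ B : ℝ}

/-- The Hilbert–Schmidt norm stands in for the operator norm of the noise: it is larger, but its
square is a sum of entries whose mean can be estimated. -/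
lemma noise_quadForm_le (hB0 : 0 ≤ B)
    (hB : ∑ i, ∑ j, (ρ * δ * (e * eᵀ) i j) ^ 2 ≤ B ^ 2) (u : Fin m → ℝ) :
    ρ * δ * ((eᵀ *ᵥ u) ⬝ᵥ (eᵀ *ᵥ u)) ≤ B * (u ⬝ᵥ u) := by
  have := (le_abs_self _).trans (abs_quadForm_le ((ρ * δ) • (e * eᵀ)) hB0 (by simpa using hB) u)
  rw [transpose_mulVec_dotProduct_self]
  simpa [smul_mulVec, dotProduct_smul] using this

/-- The `(d+1)`-st eigenvalue of the data is controlled by the noise. -/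
lemma factorModel_sortedEigenvalue_le (hρ : 0 < ρ) (hδ : 0 < δ) (hB0 : 0 ≤ B)
    (hB : ∑ i, ∑ j, (ρ * δ * (e * eᵀ) i j) ^ 2 ≤ B ^ 2) (hX : X = F * Λᵀ + e) (hdm : d < m) :
    ρ * δ * sortedEigenvalue X d ≤ B := by
  have hρδ := mul_pos hρ hδ
  have := sortedEigenvalue_le X F hdm (B := B / (ρ * δ)) fun u hu => by
    have h1 : Xᵀ *ᵥ u = eᵀ *ᵥ u := by
      rw [hX, transpose_add, transpose_mul, transpose_transpose, add_mulVec, ← mulVec_mulVec, hu]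
      simp
    rw [h1, div_mul_eq_mul_div, le_div_iff₀ hρδ, mul_comm]
    exact noise_quadForm_le hB0 hB u
  rw [le_div_iff₀ hρδ] at this
  linarith

/-- The `d`-th eigenvalue of the data is bounded below by the Gram matrices of factors and
loadings, up to the noise. -/
lemma le_factorModel_sortedEigenvalue (hρ : 0 < ρ) (hδ : 0 < δ) (hB0 : 0 ≤ B)
    (hB : ∑ i, ∑ j, (ρ * δ * (e * eᵀ) i j) ^ 2 ≤ B ^ 2) (hX : X = F * Λᵀ + e)
    {k : ℕ} (hkd : k < d) (hkm : k < m) {c c' : ℝ} (hc : 0 < c) (hc' : 0 < c')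
    (hF : ∀ w : Fin d → ℝ, c * (w ⬝ᵥ w) ≤ ρ * ((F *ᵥ w) ⬝ᵥ (F *ᵥ w)))
    (hΛ : ∀ w : Fin d → ℝ, c' * (w ⬝ᵥ w) ≤ δ * ((Λ *ᵥ w) ⬝ᵥ (Λ *ᵥ w))) :
    c * c' / 2 - B ≤ ρ * δ * sortedEigenvalue X k := by
  have hρδ := mul_pos hρ hδ
  have hpos : ∀ w : Fin d → ℝ, w ≠ 0 → 0 < w ⬝ᵥ w := fun w hw => by
    simpa using dotProduct_star_self_pos_iff.2 hw
  have := le_sortedEigenvalue X F hkd hkm (B := (c * c' / 2 - B) / (ρ * δ))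
    (fun w hw => pos_of_mul_pos_right ((mul_pos hc (hpos w hw)).trans_le (hF w)) hρ.le) fun w => by
    rcases eq_or_ne w 0 with rfl | hw
    · simp
    set u := F *ᵥ w with hu
    set g := Fᵀ *ᵥ u with hg
    have h1 : Xᵀ *ᵥ u = Λ *ᵥ g + eᵀ *ᵥ u := by
      rw [hX, transpose_add, transpose_mul, transpose_transpose, add_mulVec, ← mulVec_mulVec]
    -- Coordinatewise, `(x + y)² - x²/2 + y² = (x + 2y)²/2 ≥ 0`; this absorbs the cross term between
    -- signal and noise.
    have h2 : (Λ *ᵥ g) ⬝ᵥ (Λ *ᵥ g) / 2 - (eᵀ *ᵥ u) ⬝ᵥ (eᵀ *ᵥ u) ≤ (Xᵀ *ᵥ u) ⬝ᵥ (Xᵀ *ᵥ u) := by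
      rw [h1]
      simp only [dotProduct, Finset.sum_div, ← Finset.sum_sub_distrib, Pi.add_apply]
      refine Finset.sum_le_sum fun i _ => ?_
      nlinarith [sq_nonneg ((Λ *ᵥ g) i + 2 * (eᵀ *ᵥ u) i)]
    have h3 : w ⬝ᵥ g = u ⬝ᵥ u := by
      rw [hg, dotProduct_mulVec, vecMul_transpose]
    -- The lower bound for `F` passes to `Fᵀ` on the range of `F`: Cauchy–Schwarz applied to `w ⬝ᵥ g
    -- = u ⬝ᵥ u`, then division by `w ⬝ᵥ w`.
    have h4 : c * (u ⬝ᵥ u) ≤ ρ * (g ⬝ᵥ g) := by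
      have h5 := sq_dotProduct_le w g
      rw [h3] at h5
      have h6 := hF w
      have hw0 := hpos w hw
      have huu := dotProduct_self_nonneg_real u
      refine le_of_mul_le_mul_right ?_ hw0
      calc c * (u ⬝ᵥ u) * (w ⬝ᵥ w) = (u ⬝ᵥ u) * (c * (w ⬝ᵥ w)) := by ring
        _ ≤ (u ⬝ᵥ u) * (ρ * (u ⬝ᵥ u)) := mul_le_mul_of_nonneg_left h6 huu
        _ = ρ * (u ⬝ᵥ u) ^ 2 := by ring
        _ ≤ ρ * ((w ⬝ᵥ w) * (g ⬝ᵥ g)) := mul_le_mul_of_nonneg_left h5 hρ.le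
        _ = _ := by ring
    have h7 : c * c' * (u ⬝ᵥ u) ≤ ρ * δ * ((Λ *ᵥ g) ⬝ᵥ (Λ *ᵥ g)) := by
      calc c * c' * (u ⬝ᵥ u) = c' * (c * (u ⬝ᵥ u)) := by ring
        _ ≤ c' * (ρ * (g ⬝ᵥ g)) := mul_le_mul_of_nonneg_left h4 hc'.le
        _ = ρ * (c' * (g ⬝ᵥ g)) := by ring
        _ ≤ ρ * (δ * ((Λ *ᵥ g) ⬝ᵥ (Λ *ᵥ g))) := mul_le_mul_of_nonneg_left (hΛ g) hρ.le
        _ = _ := by ring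
    have h8 := noise_quadForm_le hB0 hB u
    have h9 := mul_le_mul_of_nonneg_left h2 hρδ.le
    rw [div_mul_eq_mul_div, div_le_iff₀ hρδ]
    linarith
  rw [div_le_iff₀ hρδ] at this
  linarith

/-- The least-squares residual in terms of the eigenvalues of `X Xᵀ`. -/
lemma residual_eq {k : ℕ} {Y : Matrix (Fin m) (Fin k) ℝ} (hρ : 0 < ρ) (hδ : 0 < δ)
    (hY : IsFactorEstimator ρ X Y) :
    residual ρ δ X Y
      = ρ * δ * (∑ i, ∑ j, X i j ^ 2 - ∑ r ∈ Finset.range k, sortedEigenvalue X r) := by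
  obtain ⟨hY1, hY2⟩ := hY
  have hYY : ∀ r s, ∑ i, Y i r * Y i s = if r = s then ρ⁻¹ else 0 := by
    intro r s
    have h := congrFun (congrFun hY1 r) s
    simp only [Matrix.smul_apply, mul_apply, transpose_apply, smul_eq_mul, one_apply] at h
    have : ∑ i, Y i r * Y i s = ρ⁻¹ * (if r = s then 1 else 0) := by
      rw [← h, inv_mul_cancel_left₀ hρ.ne']
    simpa using this
  -- Completing the square in one column of the data: the optimal loadings are `ρ Yᵀ x`.
  have hcol : ∀ (g : Fin k → ℝ) (x : Fin m → ℝ),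
      ∑ i, (x i - ∑ r, g r * Y i r) ^ 2
        = ∑ i, x i ^ 2 - ρ * ∑ r, (∑ i, Y i r * x i) ^ 2
          + ρ⁻¹ * ∑ r, (g r - ρ * ∑ i, Y i r * x i) ^ 2 := by
    intro g x
    have h1 : ∑ i, (∑ r, g r * Y i r) ^ 2 = ρ⁻¹ * ∑ r, g r ^ 2 := by
      calc ∑ i, (∑ r, g r * Y i r) ^ 2
          = ∑ i, ∑ r, ∑ s, g r * g s * (Y i r * Y i s) := by
            refine Finset.sum_congr rfl fun i _ => ?_
            rw [sq, Finset.sum_mul_sum]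
            exact Finset.sum_congr rfl fun r _ => Finset.sum_congr rfl fun s _ => by ring
        _ = ∑ r, ∑ s, g r * g s * ∑ i, Y i r * Y i s := by
            rw [Finset.sum_comm]
            refine Finset.sum_congr rfl fun r _ => ?_
            rw [Finset.sum_comm]
            simp only [Finset.mul_sum]
        _ = _ := by
            simp only [hYY, mul_ite, mul_zero, Finset.sum_ite_eq, Finset.mem_univ, if_true]
            rw [Finset.mul_sum]
            exact Finset.sum_congr rfl fun r _ => by ring
    have h2 : ∑ i, x i * ∑ r, g r * Y i r = ∑ r, g r * ∑ i, Y i r * x i := by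
      simp only [Finset.mul_sum]
      rw [Finset.sum_comm]
      exact Finset.sum_congr rfl fun r _ => Finset.sum_congr rfl fun i _ => by ring
    have h3 : ∀ i, (x i - ∑ r, g r * Y i r) ^ 2
        = x i ^ 2 - 2 * (x i * ∑ r, g r * Y i r) + (∑ r, g r * Y i r) ^ 2 := fun i => by ring
    have h4 : ∀ r, (g r - ρ * ∑ i, Y i r * x i) ^ 2
        = g r ^ 2 - 2 * ρ * (g r * ∑ i, Y i r * x i) + ρ ^ 2 * (∑ i, Y i r * x i) ^ 2 :=
      fun r => by ring
    simp only [h3, h4, Finset.sum_add_distrib, Finset.sum_sub_distrib, ← Finset.mul_sum, h1, h2]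
    field_simp
    ring
  have heig : ∑ j, ∑ r, (∑ i, Y i r * X i j) ^ 2
      = ρ⁻¹ * ∑ r ∈ Finset.range k, sortedEigenvalue X r := by
    rw [Finset.sum_comm, Finset.mul_sum, ← Fin.sum_univ_eq_sum_range
      (fun r => ρ⁻¹ * sortedEigenvalue X r)]
    refine Finset.sum_congr rfl fun r _ => ?_
    have h1 := transpose_mulVec_dotProduct_self X (fun i => Y i r)
    rw [hY2 r, dotProduct_smul] at h1
    have h2 : (fun i => Y i r) ⬝ᵥ (fun i => Y i r) = ρ⁻¹ := by
      simpa [dotProduct] using hYY r r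
    rw [h2] at h1
    rw [smul_eq_mul, mul_comm] at h1
    rw [← h1]
    simp only [dotProduct, mulVec, transpose_apply, sq]
    simp only [mul_comm]
  have hval : ∀ g : Matrix (Fin l) (Fin k) ℝ,
      ρ * δ * ∑ i, ∑ j, (X i j - ∑ r, g j r * Y i r) ^ 2
        = ρ * δ * (∑ i, ∑ j, X i j ^ 2 - ∑ r ∈ Finset.range k, sortedEigenvalue X r)
          + δ * ∑ j, ∑ r, (g j r - ρ * ∑ i, Y i r * X i j) ^ 2 := by
    intro g
    rw [Finset.sum_comm]
    simp only [fun j => hcol (g j) fun i => X i j, Finset.sum_add_distrib, Finset.sum_sub_distrib,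
      ← Finset.mul_sum, heig]
    rw [Finset.sum_comm (f := fun j i => X i j ^ 2)]
    field_simp
  rw [residual]
  refine le_antisymm ?_ (le_ciInf fun g => ?_)
  · refine (ciInf_le ⟨0, ?_⟩ (Matrix.of fun j r => ρ * ∑ i, Y i r * X i j)).trans ?_
    · rintro _ ⟨g, rfl⟩
      positivity
    · rw [hval]; simp
  · rw [hval]
    have : 0 ≤ δ * ∑ j, ∑ r, (g j r - ρ * ∑ i, Y i r * X i j) ^ 2 := by positivity
    linarith

/-- A minimizer of the information criterion equals the number of factors, if the penalty dominates
the noise and is small compared with the signal. -/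
lemma eq_of_PC_le (hρ : 0 < ρ) (hδ : 0 < δ) (hB0 : 0 ≤ B)
    (hB : ∑ i, ∑ j, (ρ * δ * (e * eᵀ) i j) ^ 2 ≤ B ^ 2) (hX : X = F * Λᵀ + e)
    {c c' q : ℝ} (hc : 0 < c) (hc' : 0 < c')
    (hF : ∀ w : Fin d → ℝ, c * (w ⬝ᵥ w) ≤ ρ * ((F *ᵥ w) ⬝ᵥ (F *ᵥ w)))
    (hΛ : ∀ w : Fin d → ℝ, c' * (w ⬝ᵥ w) ≤ δ * ((Λ *ᵥ w) ⬝ᵥ (Λ *ᵥ w)))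
    (hBq : B < q) (hq : 2 * q < c * c' / 2) {k : ℕ} (hkm : k < m) (hdm : d < m)
    {Y : Matrix (Fin m) (Fin k) ℝ} {Y' : Matrix (Fin m) (Fin d) ℝ}
    (hY : IsFactorEstimator ρ X Y) (hY' : IsFactorEstimator ρ X Y')
    (hPC : PC ρ δ q X Y ≤ PC ρ δ q X Y') : k = d := by
  rw [PC, PC, residual_eq hρ hδ hY, residual_eq hρ hδ hY'] at hPC
  have hρδ := mul_pos hρ hδ
  rcases lt_trichotomy k d with h | h | h
  · exfalso
    have h1 := Finset.sum_range_add_sum_Ico (fun r => sortedEigenvalue X r) h.le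
    -- Every omitted factor would gain more than its price: `c c'/2 - B > 2q - q = q`.
    have h2 : ∀ r ∈ Finset.Ico k d, q < ρ * δ * sortedEigenvalue X r := by
      intro r hr
      have hr := Finset.mem_Ico.1 hr
      have := le_factorModel_sortedEigenvalue hρ hδ hB0 hB hX hr.2 (hr.2.trans hdm) hc hc' hF hΛ
      linarith
    have h3 := Finset.sum_lt_sum_of_nonempty (Finset.nonempty_Ico.2 h) h2
    rw [← Finset.mul_sum, Finset.sum_const, Nat.card_Ico, nsmul_eq_mul, Nat.cast_sub h.le] at h3
    rw [← h1] at hPC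
    nlinarith
  · exact h
  · exfalso
    have h1 := Finset.sum_range_add_sum_Ico (fun r => sortedEigenvalue X r) h.le
    -- Every superfluous factor gains at most `B < q`.
    have h2 : ∀ r ∈ Finset.Ico d k, ρ * δ * sortedEigenvalue X r < q := by
      intro r hr
      have hr := Finset.mem_Ico.1 hr
      have h4 := factorModel_sortedEigenvalue_le hρ hδ hB0 hB hX hdm
      have h5 := mul_le_mul_of_nonneg_left
        (sortedEigenvalue_antitone X hr.1 (hr.2.trans hkm)) hρδ.le
      linarith
    have h3 := Finset.sum_lt_sum_of_nonempty (Finset.nonempty_Ico.2 h) h2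
    rw [← Finset.mul_sum, Finset.sum_const, Nat.card_Ico, nsmul_eq_mul, Nat.cast_sub h.le] at h3
    rw [← h1] at hPC
    nlinarith

end FactorModel

/-! ### Lower bounds for quadratic forms -/

/-- The form attains a positive minimum on the compact unit sphere. This is the sup-norm sphere,
hence the conversion factor from `w ⬝ᵥ w ≤ (d + 1) ‖w‖²`; `d + 1` keeps the divisor positive. The
sphere is empty when `d = 0`. -/
lemma exists_pos_le_quadForm {d : ℕ} {A : Matrix (Fin d) (Fin d) ℝ} (hA : A.PosDef) :
    ∃ c : ℝ, 0 < c ∧ ∀ w : Fin d → ℝ, c * (w ⬝ᵥ w) ≤ w ⬝ᵥ (A *ᵥ w) := by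
  rcases (Metric.sphere (0 : Fin d → ℝ) 1).eq_empty_or_nonempty with h | h
  · refine ⟨1, one_pos, fun w => ?_⟩
    have hw : w = 0 := by
      by_contra hw
      have : ‖w‖⁻¹ • w ∈ Metric.sphere (0 : Fin d → ℝ) 1 := by
        simp [norm_smul, inv_mul_cancel₀ (norm_ne_zero_iff.2 hw)]
      simp [h] at this
    simp [hw]
  · have hcont : Continuous fun w : Fin d → ℝ => w ⬝ᵥ (A *ᵥ w) := by
      simp only [dotProduct, mulVec]
      fun_prop
    obtain ⟨w₀, hw₀, hmin⟩ := (isCompact_sphere (0 : Fin d → ℝ) 1).exists_isMinOn h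
      hcont.continuousOn
    have hw₀' : w₀ ≠ 0 := by
      rintro rfl
      simp at hw₀
    have hpos : 0 < w₀ ⬝ᵥ (A *ᵥ w₀) := by simpa using hA.dotProduct_mulVec_pos hw₀'
    have hbound : ∀ w : Fin d → ℝ, w₀ ⬝ᵥ (A *ᵥ w₀) * ‖w‖ ^ 2 ≤ w ⬝ᵥ (A *ᵥ w) := by
      intro w
      rcases eq_or_ne w 0 with rfl | hw
      · simp
      have hn := norm_pos_iff.2 hw
      have h1 : ‖w‖⁻¹ • w ∈ Metric.sphere (0 : Fin d → ℝ) 1 := by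
        simp [norm_smul, inv_mul_cancel₀ hn.ne']
      have h2 := hmin h1
      simp only [Set.mem_ofPred_eq, mulVec_smul, dotProduct_smul, smul_dotProduct,
        smul_eq_mul] at h2
      calc w₀ ⬝ᵥ (A *ᵥ w₀) * ‖w‖ ^ 2
          ≤ ‖w‖⁻¹ * (‖w‖⁻¹ * (w ⬝ᵥ (A *ᵥ w))) * ‖w‖ ^ 2 :=
            mul_le_mul_of_nonneg_right h2 (sq_nonneg _)
        _ = _ := by field_simp
    refine ⟨w₀ ⬝ᵥ (A *ᵥ w₀) / (d + 1), by positivity, fun w => (le_trans ?_ (hbound w))⟩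
    have h1 : w ⬝ᵥ w ≤ (d + 1) * ‖w‖ ^ 2 := by
      calc w ⬝ᵥ w = ∑ i, |w i| ^ 2 := by simp [dotProduct, sq]
        _ ≤ ∑ _i : Fin d, ‖w‖ ^ 2 := Finset.sum_le_sum fun i _ =>
            pow_le_pow_left₀ (abs_nonneg _) (norm_le_pi_norm w i) 2
        _ = d * ‖w‖ ^ 2 := by simp
        _ ≤ _ := by nlinarith [sq_nonneg ‖w‖]
    rw [div_mul_eq_mul_div, div_le_iff₀ (by positivity)]
    nlinarith [mul_le_mul_of_nonneg_left h1 hpos.le]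

/-- Entries of size at most `κ` give a Hilbert–Schmidt norm of at most `d κ`, which is all the lower
bound can lose. -/
lemma quadForm_lower_bound_of_close {d : ℕ} {A B : Matrix (Fin d) (Fin d) ℝ} {c κ : ℝ}
    (hκ : 0 ≤ κ) (hAB : ∀ k l, |A k l - B k l| ≤ κ)
    (hB : ∀ w : Fin d → ℝ, c * (w ⬝ᵥ w) ≤ w ⬝ᵥ (B *ᵥ w)) (w : Fin d → ℝ) :
    (c - d * κ) * (w ⬝ᵥ w) ≤ w ⬝ᵥ (A *ᵥ w) := by
  have h1 : ∑ i, ∑ j, (A - B) i j ^ 2 ≤ (d * κ) ^ 2 := by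
    calc ∑ i, ∑ j, (A - B) i j ^ 2 ≤ ∑ _i : Fin d, ∑ _j : Fin d, κ ^ 2 :=
          Finset.sum_le_sum fun i _ => Finset.sum_le_sum fun j _ => by
            rw [Matrix.sub_apply, ← sq_abs]
            exact pow_le_pow_left₀ (abs_nonneg _) (hAB i j) 2
      _ = _ := by simp; ring
  have h2 := (abs_le.1 (abs_quadForm_le (A - B) (by positivity) h1 w)).1
  rw [sub_mulVec, dotProduct_sub] at h2
  linarith [hB w]

lemma smul_mulVec_dotProduct_self {m d : ℕ} (F : Matrix (Fin m) (Fin d) ℝ) (ρ : ℝ)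
    (w : Fin d → ℝ) :
    ρ * ((F *ᵥ w) ⬝ᵥ (F *ᵥ w)) = w ⬝ᵥ ((ρ • (Fᵀ * F)) *ᵥ w) := by
  have := transpose_mulVec_dotProduct_self Fᵀ w
  rw [transpose_transpose] at this
  rw [this, smul_mulVec, dotProduct_smul, smul_eq_mul]

lemma abs_le_hsNorm {m k : ℕ} (A : Matrix (Fin m) (Fin k) ℝ) (i : Fin m) (j : Fin k) :
    |A i j| ≤ hsNorm A := by
  refine Real.abs_le_sqrt ?_
  exact (Finset.single_le_sum (f := fun j => A i j ^ 2) (fun _ _ => sq_nonneg _)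
    (Finset.mem_univ j)).trans (Finset.single_le_sum (f := fun i => ∑ j, A i j ^ 2)
      (fun _ _ => Finset.sum_nonneg fun _ _ => sq_nonneg _) (Finset.mem_univ i))

/-- An almost surely positive definite random matrix is bounded below with high probability. -/
lemma exists_measure_quadForm_lt_le {Ω : Type*} {mΩ : MeasurableSpace Ω} (P : Measure Ω)
    [IsProbabilityMeasure P] {d : ℕ} {S : Ω → Matrix (Fin d) (Fin d) ℝ}
    (hS : ∀ k l, AEMeasurable (fun ω => S ω k l) P) (hpos : ∀ᵐ ω ∂P, (S ω).PosDef)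
    {η : ℝ≥0∞} (hη : 0 < η) :
    ∃ c : ℝ, 0 < c ∧
      P {ω | ¬ ∀ w : Fin d → ℝ, c * (w ⬝ᵥ w) ≤ w ⬝ᵥ (S ω *ᵥ w)} ≤ η := by
  -- These sets increase with `n`, are closed and hence measurable, and every positive definite
  -- matrix lies in one of them; continuity from above applies to their complements.
  let G : ℕ → Set (Fin d → Fin d → ℝ) := fun n =>
    {A | ∀ w : Fin d → ℝ, 1 / ((n : ℝ) + 1) * (w ⬝ᵥ w) ≤ w ⬝ᵥ (Matrix.of A *ᵥ w)}
  have hG : ∀ n, IsClosed (G n) := by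
    intro n
    simp only [G, Set.ofPred_forall]
    refine isClosed_iInter fun w => isClosed_le continuous_const ?_
    simp only [dotProduct, mulVec, Matrix.of_apply]
    fun_prop
  have hmono : Monotone G := by
    intro i j hij A hA w
    refine le_trans ?_ (hA w)
    exact mul_le_mul_of_nonneg_right (Nat.one_div_le_one_div hij) (dotProduct_self_nonneg_real w)
  have hSm : AEMeasurable (fun ω k l => S ω k l) P :=
    aemeasurable_pi_iff.2 fun k => aemeasurable_pi_iff.2 fun l => hS k l
  have hlim := tendsto_measure_iInter_atTop (μ := P)
    (s := fun n => (fun ω k l => S ω k l) ⁻¹' (G n)ᶜ)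
    (fun n => hSm.nullMeasurable (hG n).measurableSet.compl)
    (fun i j hij => Set.preimage_mono (Set.compl_subset_compl.2 (hmono hij)))
    ⟨0, measure_ne_top _ _⟩
  have hzero : P (⋂ n, (fun ω k l => S ω k l) ⁻¹' (G n)ᶜ) = 0 := by
    refine measure_mono_null (t := {ω | ¬ (S ω).PosDef}) ?_ hpos
    intro ω hω hpd
    obtain ⟨c, hc, hcw⟩ := exists_pos_le_quadForm hpd
    obtain ⟨n, hn⟩ := exists_nat_one_div_lt hc
    exact Set.mem_iInter.1 hω n fun w =>
      (mul_le_mul_of_nonneg_right hn.le (dotProduct_self_nonneg_real w)).trans (hcw w)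
  rw [hzero] at hlim
  obtain ⟨n, hn⟩ := (ENNReal.tendsto_nhds_zero.1 hlim η hη).exists
  exact ⟨1 / ((n : ℝ) + 1), by positivity, hn⟩

/-! ### Size of the noise -/

lemma integrable_mul_of_lintegral_enorm_pow_lt_top {Ω : Type*} {mΩ : MeasurableSpace Ω}
    {P : Measure Ω} [IsFiniteMeasure P] {f g : Ω → ℝ} (hf : Measurable f) (hg : Measurable g)
    (hf8 : ∫⁻ ω, ‖f ω‖ₑ ^ 8 ∂P < ∞) (hg8 : ∫⁻ ω, ‖g ω‖ₑ ^ 8 ∂P < ∞) :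
    Integrable (fun ω => f ω * g ω) P := by
  have key : ∀ h : Ω → ℝ, Measurable h → ∫⁻ ω, ‖h ω‖ₑ ^ 8 ∂P < ∞ → MemLp h 2 P := by
    intro h hm h8
    have : MemLp h 8 P := by
      refine ⟨hm.aestronglyMeasurable, ?_⟩
      rw [eLpNorm_lt_top_iff_lintegral_rpow_enorm_lt_top (by norm_num) (by norm_num)]
      simpa using h8
    exact this.mono_exponent (by norm_num)
  exact (key f hf hf8).integrable_mul (key g hg hg8)

section Noise

variable {Ω : Type*} {mΩ : MeasurableSpace Ω} {T a b : ℝ} {d : ℕ} {nbar Nbar : ℕ → ℕ}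
  {P : Measure Ω}
  {tm : (n : ℕ) → Fin (nbar n) → Set.Icc (0 : ℝ) T} {ρ : ℕ → ℝ}
  {xs : (N : ℕ) → Fin (Nbar N) → Set.Icc a b} {δ : ℕ → ℝ}
  {Z : Fin d → Set.Icc (0 : ℝ) T → Ω → ℝ}
  {ε : Set.Icc (0 : ℝ) T → Set.Icc a b → Ω → ℝ}

lemma NoiseAssumption.integrable_mul [IsProbabilityMeasure P]
    (h : NoiseAssumption P tm ρ xs δ Z ε) (n N : ℕ)
    (i j : Fin (nbar n)) (k l : Fin (Nbar N)) :
    Integrable (fun ω => ε (tm n i) (xs N k) ω * ε (tm n j) (xs N l) ω) P := by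
  have key : ∀ i k, ∫⁻ ω, ‖ε (tm n i) (xs N k) ω‖ₑ ^ 8 ∂P < ∞ := fun i k =>
    (lintegral_mono fun ω => le_iSup₂ (f := fun i k => ‖ε (tm n i) (xs N k) ω‖ₑ ^ 8) i k).trans_lt
      (h.moment n N)
  exact integrable_mul_of_lintegral_enorm_pow_lt_top (h.measurable _ _) (h.measurable _ _)
    (key i k) (key j l)

/-- Only the diagonal is bounded by assumption; `|xy| ≤ (x² + y²)/2` carries the bound to all pairs
of times. -/
lemma NoiseAssumption.exists_abs_gammaN_le [IsProbabilityMeasure P]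
    (h : NoiseAssumption P tm ρ xs δ Z ε)
    (hδ : ∀ N, 0 < δ N) :
    ∃ M : ℝ, 0 ≤ M ∧ ∀ n N i j, |gammaN P xs δ ε N (tm n i) (tm n j)| ≤ M := by
  obtain ⟨M, hM⟩ := h.gamma_diag
  refine ⟨|M|, abs_nonneg M, fun n N i j => le_trans ?_ (le_abs_self M)⟩
  have hint : ∀ i j, Integrable (fun ω => ∑ l, ε (tm n i) (xs N l) ω * ε (tm n j) (xs N l) ω) P :=
    fun i j => integrable_finsetSum _ fun l _ => h.integrable_mul n N i j l l
  have h1 : |∫ ω, ∑ l, ε (tm n i) (xs N l) ω * ε (tm n j) (xs N l) ω ∂P|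
      ≤ ∫ ω, ((∑ l, ε (tm n i) (xs N l) ω * ε (tm n i) (xs N l) ω)
        + ∑ l, ε (tm n j) (xs N l) ω * ε (tm n j) (xs N l) ω) / 2 ∂P := by
    refine abs_integral_le_integral_abs.trans (integral_mono (hint i j).abs
      (((hint i i).add (hint j j)).div_const 2) fun ω => ?_)
    refine (Finset.abs_sum_le_sum_abs _ _).trans ?_
    simp only [← Finset.sum_add_distrib, Finset.sum_div]
    refine Finset.sum_le_sum fun l _ => abs_le.2 ⟨?_, ?_⟩
    · nlinarith [sq_nonneg (ε (tm n i) (xs N l) ω + ε (tm n j) (xs N l) ω)]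
    · nlinarith [sq_nonneg (ε (tm n i) (xs N l) ω - ε (tm n j) (xs N l) ω)]
  rw [integral_div, integral_add (hint i i) (hint j j)] at h1
  have h2 := hM n N i
  have h3 := hM n N j
  have h4 := mul_le_mul_of_nonneg_left h1 (hδ N).le
  rw [gammaN, abs_mul, abs_of_pos (hδ N)]
  rw [gammaN] at h2 h3
  linarith

lemma NoiseAssumption.measurable_gram (h : NoiseAssumption P tm ρ xs δ Z ε) (n N : ℕ) :
    Measurable fun ω => ∑ i, ∑ j,
      (ρ n * δ N * ∑ l, ε (tm n i) (xs N l) ω * ε (tm n j) (xs N l) ω) ^ 2 := by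
  refine Finset.measurable_sum _ fun i _ => Finset.measurable_sum _ fun j _ =>
    Measurable.pow_const (Measurable.const_mul (Finset.measurable_sum _ fun l _ => ?_) _) _
  exact (h.measurable _ _).mul (h.measurable _ _)

/-- The squared Hilbert–Schmidt norm of the rescaled Gram matrix of the noise is of order
`ρ + δ` in mean. -/
lemma NoiseAssumption.exists_lintegral_gram_le [IsProbabilityMeasure P]
    (h : NoiseAssumption P tm ρ xs δ Z ε)
    (hδ : ∀ N, 0 < δ N) (hρ : ∀ n, 0 < ρ n) {R : ℝ} (hR : ∀ n, ρ n * nbar n ≤ R) :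
    ∃ K : ℝ, 0 ≤ K ∧ ∀ n N, ∫⁻ ω, ENNReal.ofReal (∑ i, ∑ j,
      (ρ n * δ N * ∑ l, ε (tm n i) (xs N l) ω * ε (tm n j) (xs N l) ω) ^ 2) ∂P
        ≤ ENNReal.ofReal (K * (ρ n + δ N)) := by
  obtain ⟨M, hM0, hM⟩ := h.exists_abs_gammaN_le hδ
  obtain ⟨M', hM'⟩ := h.gamma_sum
  obtain ⟨M₄, hM₄⟩ := h.fourth_moment
  refine ⟨2 * M * |M'| + 2 * R ^ 2 * (1 + M₄), by positivity, fun n N => ?_⟩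
  set γ : Fin (nbar n) → Fin (nbar n) → ℝ := fun i j => gammaN P xs δ ε N (tm n i) (tm n j) with hγ
  set ξ : Fin (nbar n) → Fin (nbar n) → Ω → ℝ := fun i j ω =>
    Real.sqrt (δ N) * ∑ l, (ε (tm n i) (xs N l) ω * ε (tm n j) (xs N l) ω
      - ∫ ω', ε (tm n i) (xs N l) ω' * ε (tm n j) (xs N l) ω' ∂P) with hξ
  -- Mean plus centered fluctuation. The means contribute `O(ρ)` to the sum of squares, the
  -- fluctuations `O(δ)`.
  have hdecomp : ∀ i j ω, δ N * ∑ l, ε (tm n i) (xs N l) ω * ε (tm n j) (xs N l) ω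
      = γ i j + Real.sqrt (δ N) * ξ i j ω := by
    intro i j ω
    simp only [hγ, hξ, gammaN]
    rw [integral_finsetSum _ fun l _ => h.integrable_mul n N i j l l, ← mul_assoc,
      Real.mul_self_sqrt (hδ N).le, Finset.sum_sub_distrib]
    ring
  have hpt : ∀ ω, ∑ i, ∑ j, (ρ n * δ N * ∑ l, ε (tm n i) (xs N l) ω * ε (tm n j) (xs N l) ω) ^ 2
      ≤ 2 * M * |M'| * ρ n + ∑ i, ∑ j, 2 * ρ n ^ 2 * δ N * (1 + |ξ i j ω| ^ 4) := by
    intro ω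
    have h1 : ∑ i, ∑ j, 2 * ρ n ^ 2 * M * |γ i j| ≤ 2 * M * |M'| * ρ n := by
      calc ∑ i, ∑ j, 2 * ρ n ^ 2 * M * |γ i j|
          = 2 * M * ρ n * (ρ n * ∑ i, ∑ j, |γ i j|) := by
            simp only [← Finset.mul_sum]; ring
        _ ≤ 2 * M * ρ n * |M'| := mul_le_mul_of_nonneg_left ((hM' n N).trans (le_abs_self _))
            (by have := hρ n; positivity)
        _ = _ := by ring
    refine le_trans ?_ (add_le_add_left h1 _)
    rw [← Finset.sum_add_distrib]
    refine Finset.sum_le_sum fun i _ => ?_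
    rw [← Finset.sum_add_distrib]
    refine Finset.sum_le_sum fun j _ => ?_
    rw [mul_assoc, hdecomp i j ω]
    -- One factor is bounded uniformly; the other is left for `gamma_sum`, which uses up one power
    -- of `ρ` out of `ρ²`.
    have h2 : γ i j ^ 2 ≤ M * |γ i j| := by
      rw [← sq_abs, sq]
      exact mul_le_mul_of_nonneg_right (hM n N i j) (abs_nonneg _)
    have h3 : ξ i j ω ^ 2 ≤ 1 + |ξ i j ω| ^ 4 := by
      rw [← sq_abs]
      nlinarith [sq_nonneg (|ξ i j ω| ^ 2 - 1), sq_nonneg (|ξ i j ω|)]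
    have h4 : (γ i j + Real.sqrt (δ N) * ξ i j ω) ^ 2 ≤ 2 * γ i j ^ 2 + 2 * (δ N * ξ i j ω ^ 2) := by
      nlinarith [sq_nonneg (γ i j - Real.sqrt (δ N) * ξ i j ω), Real.sq_sqrt (hδ N).le]
    have h5 := mul_le_mul_of_nonneg_left h3 (hδ N).le
    calc (ρ n * (γ i j + Real.sqrt (δ N) * ξ i j ω)) ^ 2
        = ρ n ^ 2 * (γ i j + Real.sqrt (δ N) * ξ i j ω) ^ 2 := by ring
      _ ≤ ρ n ^ 2 * (2 * (M * |γ i j|) + 2 * (δ N * (1 + |ξ i j ω| ^ 4))) :=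
          mul_le_mul_of_nonneg_left (by linarith) (sq_nonneg _)
      _ = _ := by ring
  have hρn := hρ n
  have hδN := hδ N
  have hξm : ∀ i j, Measurable (ξ i j) := fun i j =>
    Measurable.const_mul (Finset.measurable_sum _ fun l _ =>
      ((h.measurable _ _).mul (h.measurable _ _)).sub_const _) _
  have hterm : ∀ i j, ∫⁻ ω, ENNReal.ofReal (2 * ρ n ^ 2 * δ N * (1 + |ξ i j ω| ^ 4)) ∂P
      ≤ ENNReal.ofReal (2 * ρ n ^ 2 * δ N * (1 + M₄)) := by
    intro i j
    have h1 : ∀ ω, ENNReal.ofReal (2 * ρ n ^ 2 * δ N * (1 + |ξ i j ω| ^ 4))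
        = ENNReal.ofReal (2 * ρ n ^ 2 * δ N) * (1 + ‖ξ i j ω‖ₑ ^ 4) := by
      intro ω
      rw [ENNReal.ofReal_mul (by positivity), ENNReal.ofReal_add (by norm_num) (by positivity),
        ENNReal.ofReal_one, ENNReal.ofReal_pow (abs_nonneg _), Real.enorm_eq_ofReal_abs]
    simp only [h1]
    rw [lintegral_const_mul' _ _ ENNReal.ofReal_ne_top, lintegral_add_left measurable_const,
      lintegral_const, measure_univ, mul_one,
      ENNReal.ofReal_mul (p := 2 * ρ n ^ 2 * δ N) (by positivity), ENNReal.ofReal_add (by norm_num) (by positivity), ENNReal.ofReal_one, ENNReal.ofReal_coe_nnreal]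
    gcongr
    exact hM₄ n N i j
  -- The weight `ρ²` compensates the `nbar²` pairs of times.
  have hnb : ρ n ^ 2 * (nbar n : ℝ) ^ 2 ≤ R ^ 2 := by
    rw [← mul_pow]
    exact pow_le_pow_left₀ (by positivity) (hR n) 2
  calc _ ≤ ∫⁻ ω, (ENNReal.ofReal (2 * M * |M'| * ρ n)
        + ∑ i, ∑ j, ENNReal.ofReal (2 * ρ n ^ 2 * δ N * (1 + |ξ i j ω| ^ 4))) ∂P := by
        refine lintegral_mono fun ω => (ENNReal.ofReal_le_ofReal (hpt ω)).trans ?_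
        rw [ENNReal.ofReal_add (by positivity) (by positivity),
          ENNReal.ofReal_sum_of_nonneg fun i _ => by positivity]
        simp only [fun i => ENNReal.ofReal_sum_of_nonneg (s := Finset.univ)
          (f := fun j => 2 * ρ n ^ 2 * δ N * (1 + |ξ i j ω| ^ 4)) fun j _ => by positivity]
        exact le_rfl
    _ = ENNReal.ofReal (2 * M * |M'| * ρ n)
        + ∑ i, ∑ j, ∫⁻ ω, ENNReal.ofReal (2 * ρ n ^ 2 * δ N * (1 + |ξ i j ω| ^ 4)) ∂P := by
        have hm : ∀ i j, Measurable fun ω =>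
            ENNReal.ofReal (2 * ρ n ^ 2 * δ N * (1 + |ξ i j ω| ^ 4)) := fun i j => by
          have := hξm i j
          fun_prop
        rw [lintegral_add_left measurable_const, lintegral_const, measure_univ, mul_one,
          lintegral_finsetSum _ fun i _ => Finset.measurable_sum _ fun j _ => hm i j]
        simp only [fun i => lintegral_finsetSum (μ := P) Finset.univ fun j _ => hm i j]
    _ ≤ ENNReal.ofReal (2 * M * |M'| * ρ n)
        + ∑ _i : Fin (nbar n), ∑ _j : Fin (nbar n),
          ENNReal.ofReal (2 * ρ n ^ 2 * δ N * (1 + M₄)) := by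
        gcongr with i _ j _
        exact hterm i j
    _ = ENNReal.ofReal (2 * M * |M'| * ρ n
        + nbar n * (nbar n * (2 * ρ n ^ 2 * δ N * (1 + M₄)))) := by
        rw [ENNReal.ofReal_add (by positivity) (by positivity),
          ENNReal.ofReal_mul (Nat.cast_nonneg _), ENNReal.ofReal_mul (Nat.cast_nonneg _)]
        simp
    _ ≤ _ := by
        refine ENNReal.ofReal_le_ofReal ?_
        have h1 := mul_le_mul_of_nonneg_right hnb (show 0 ≤ 2 * δ N * (1 + M₄) by positivity)
        have h2 : 0 ≤ 2 * M * |M'| * δ N := by positivity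
        have h3 : 0 ≤ 2 * R ^ 2 * (1 + M₄) * ρ n := by positivity
        nlinarith

/-- The Hilbert–Schmidt norm of the rescaled Gram matrix of the noise is negligible compared with
the penalty. -/
lemma NoiseAssumption.tendsto_measure_gram_ge [IsProbabilityMeasure P]
    (h : NoiseAssumption P tm ρ xs δ Z ε)
    (hδ : ∀ N, 0 < δ N) (hρ : ∀ n, 0 < ρ n) {R : ℝ} (hR : ∀ n, ρ n * nbar n ≤ R)
    {q : ℕ → ℕ → ℝ}
    (hCq : Tendsto (fun p : ℕ × ℕ =>
      min ((δ p.2) ^ (-(1 / 2) : ℝ)) ((ρ p.1) ^ (-(1 / 2) : ℝ)) * q p.1 p.2)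
      (atTop ×ˢ atTop) atTop) :
    Tendsto (fun p : ℕ × ℕ => P {ω | q p.1 p.2 ^ 2 ≤ ∑ i, ∑ j,
      (ρ p.1 * δ p.2 * ∑ l, ε (tm p.1 i) (xs p.2 l) ω * ε (tm p.1 j) (xs p.2 l) ω) ^ 2})
      (atTop ×ˢ atTop) (𝓝 0) := by
  obtain ⟨K, hK0, hK⟩ := h.exists_lintegral_gram_le hδ hρ hR
  have hlim : Tendsto (fun p : ℕ × ℕ => ENNReal.ofReal (2 * K /
      (min ((δ p.2) ^ (-(1 / 2) : ℝ)) ((ρ p.1) ^ (-(1 / 2) : ℝ)) * q p.1 p.2) ^ 2))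
      (atTop ×ˢ atTop) (𝓝 0) := by
    rw [← ENNReal.ofReal_zero]
    refine (ENNReal.continuous_ofReal.tendsto 0).comp ?_
    exact Tendsto.const_div_atTop ((tendsto_pow_atTop two_ne_zero).comp hCq) _
  refine tendsto_of_tendsto_of_tendsto_of_le_of_le' tendsto_const_nhds hlim
    (Eventually.of_forall fun _ => zero_le) ?_
  -- Markov's inequality at level `q²` needs `q > 0`, which is only known eventually, through `C q →
  -- ∞`.
  filter_upwards [hCq.eventually_gt_atTop 0] with ⟨n, N⟩ hpos
  simp only at hpos ⊢
  set C := min ((δ N) ^ (-(1 / 2) : ℝ)) ((ρ n) ^ (-(1 / 2) : ℝ)) with hC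
  have hCpos : 0 < C := lt_min (Real.rpow_pos_of_pos (hδ N) _) (Real.rpow_pos_of_pos (hρ n) _)
  have hqpos : 0 < q n N := pos_of_mul_pos_right hpos hCpos.le
  -- Applied to `δ` and `ρ`, this gives `C² (ρ + δ) ≤ 2`, so the Markov bound becomes `2K / (C q)²`.
  have hsq : ∀ x : ℝ, 0 < x → C ≤ x ^ (-(1 / 2) : ℝ) → C ^ 2 * x ≤ 1 := by
    intro x hx hCx
    have h1 : C ^ 2 ≤ (x ^ (-(1 / 2) : ℝ)) ^ 2 := pow_le_pow_left₀ hCpos.le hCx 2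
    have h2 : (x ^ (-(1 / 2) : ℝ)) ^ 2 = x⁻¹ := by
      rw [← Real.rpow_natCast, ← Real.rpow_mul hx.le, ← Real.rpow_neg_one]
      norm_num
    rw [h2] at h1
    calc C ^ 2 * x ≤ x⁻¹ * x := mul_le_mul_of_nonneg_right h1 hx.le
      _ = 1 := inv_mul_cancel₀ hx.ne'
  have h1 := hsq _ (hδ N) (min_le_left _ _)
  have h2 := hsq _ (hρ n) (min_le_right _ _)
  have h3 : K * (ρ n + δ N) / q n N ^ 2 ≤ 2 * K / (C * q n N) ^ 2 := by
    rw [div_le_div_iff₀ (by positivity) (by positivity)]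
    have h4 : C ^ 2 * (ρ n + δ N) ≤ 2 := by linarith
    have h5 := mul_le_mul_of_nonneg_left h4 (show 0 ≤ K * q n N ^ 2 by positivity)
    nlinarith
  refine le_trans ?_ (ENNReal.ofReal_le_ofReal h3)
  rw [ENNReal.ofReal_div_of_pos (by positivity)]
  refine le_trans ?_ (ENNReal.div_le_div_right (hK n N) _)
  refine le_trans (measure_mono fun ω hω => ?_) (meas_ge_le_lintegral_div
    (h.measurable_gram n N).ennreal_ofReal.aemeasurable
    (by simpa using hqpos.ne') ENNReal.ofReal_ne_top)
  exact ENNReal.ofReal_le_ofReal hω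

end Noise

lemma mesh_pos {a b : ℝ} (hab : a < b) {m : ℕ} (hm : 2 ≤ m) : 0 < mesh a b m := by
  have : (2 : ℝ) ≤ m := by exact_mod_cast hm
  exact div_pos (sub_pos.2 hab) (by linarith)

/-- The factor `2` bounds `m / (m - 1)` for `m ≥ 2`. -/
lemma mesh_mul_le {a b : ℝ} (hab : a < b) {m : ℕ} (hm : 2 ≤ m) :
    mesh a b m * m ≤ 2 * (b - a) := by
  have h2 : (2 : ℝ) ≤ m := by exact_mod_cast hm
  have hba := sub_pos.2 hab
  rw [mesh, div_mul_eq_mul_div, div_le_iff₀ (by linarith)]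
  nlinarith

end FactorSPDE

/-! ### Consistency of the dimension estimator. -/

open FactorSPDE in
theorem lemma6 {Ω : Type*} {mΩ : MeasurableSpace Ω} (P : Measure Ω) [IsProbabilityMeasure P]
    {T a b : ℝ} (hT : 0 < T) (hab : a < b)
    (𝓕 : Filtration (Set.Icc (0 : ℝ) T) mΩ)
    -- the generating subspace `V` of dimension `d ≥ 1`, with basis `lam`
    {d : ℕ} (hd : 1 ≤ d)
    (V : Submodule ℝ (Set.Icc a b → ℝ)) (hV : V ≤ stateSpace a b)
    (lam : Module.Basis (Fin d) ℝ V)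
    -- the space-time process `r`, its known shift `φ`, its factors `Z`, the noise, the observations
    (r : Set.Icc (0 : ℝ) T → Set.Icc a b → Ω → ℝ) (φ : Set.Icc (0 : ℝ) T → Set.Icc a b → ℝ)
    (Z : Fin d → Set.Icc (0 : ℝ) T → Ω → ℝ)
    (ε X : Set.Icc (0 : ℝ) T → Set.Icc a b → Ω → ℝ)
    (hr : ∀ᵐ ω ∂P, ∀ t x, r t x ω = φ t x + ∑ k, Z k t ω * (lam k : Set.Icc a b → ℝ) x)
    (hX : ∀ t x ω, X t x ω = r t x ω + ε t x ω)
    -- numbers of sampling points in time and space, meshes, and equidistant grids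
    (nbar Nbar : ℕ → ℕ) (hnbar2 : ∀ n, 2 ≤ nbar n) (hNbar2 : ∀ N, 2 ≤ Nbar N)
    (hnbar : Tendsto nbar atTop atTop) (hNbar : Tendsto Nbar atTop atTop)
    (ρ δ : ℕ → ℝ) (hρ : ∀ n, ρ n = mesh 0 T (nbar n)) (hδ : ∀ N, δ N = mesh a b (Nbar N))
    (tm : (n : ℕ) → Fin (nbar n) → Set.Icc (0 : ℝ) T)
    (htm : ∀ n i, tm n i = gridPoint hT.le (nbar n) i)
    (xs : (N : ℕ) → Fin (Nbar N) → Set.Icc a b)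
    (hxs : ∀ N j, xs N j = gridPoint hab.le (Nbar N) j)
    (hD1 : FactorAssumption P 𝓕 tm ρ Z)
    (hD2 : LoadingAssumption xs δ (fun k => (lam k : Set.Icc a b → ℝ)))
    (hD3 : NoiseAssumption P tm ρ xs δ Z ε)
    (hD4 : MixedMomentAssumption P tm ρ xs δ Z (fun k => (lam k : Set.Icc a b → ℝ)) ε)
    (hdistinct : ∀ᵐ ω ∂P, HasDistinctEigenvalues
      (sigmaLambda (fun k => (lam k : Set.Icc a b → ℝ)) * sigmaZ Z ω))
    -- the penalty
    (q : ℕ → ℕ → ℝ)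
    (hq : Tendsto (fun p : ℕ × ℕ => q p.1 p.2) (atTop ×ˢ atTop) (𝓝 0))
    (hCq : Tendsto (fun p : ℕ × ℕ =>
      min ((δ p.2) ^ (-(1 / 2) : ℝ)) ((ρ p.1) ^ (-(1 / 2) : ℝ)) * q p.1 p.2)
      (atTop ×ˢ atTop) atTop)
    -- the factor estimators (any choice of the eigenvectors) and the dimension estimator
    (kmax : ℕ) (hkmax : d ≤ kmax)
    (Yhat : (n N k : ℕ) → Ω → Matrix (Fin (nbar n)) (Fin k) ℝ)
    (hYhat : ∀ n N k, 1 ≤ k → k ≤ kmax → k < min (nbar n) (Nbar N) →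
      ∀ᵐ ω ∂P, IsFactorEstimator (ρ n) (dataMatrix X φ (tm n) (xs N) ω) (Yhat n N k ω))
    (dhat : ℕ → ℕ → Ω → ℕ)
    (hdhat : ∀ n N, ∀ᵐ ω ∂P, dhat n N ω ∈ Finset.Icc 1 kmax ∧
      ∀ k ∈ Finset.Icc 1 kmax,
        PC (ρ n) (δ N) (q n N) (dataMatrix X φ (tm n) (xs N) ω) (Yhat n N (dhat n N ω) ω)
          ≤ PC (ρ n) (δ N) (q n N) (dataMatrix X φ (tm n) (xs N) ω) (Yhat n N k ω)) :
    Tendsto (fun p : ℕ × ℕ => P {ω | dhat p.1 p.2 ω = Module.finrank ℝ V})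
      (atTop ×ˢ atTop) (𝓝 1) := by
  rw [Module.finrank_eq_card_basis lam, Fintype.card_fin]
  have hρpos : ∀ n, 0 < ρ n := fun n => hρ n ▸ mesh_pos hT (hnbar2 n)
  have hδpos : ∀ N, 0 < δ N := fun N => hδ N ▸ mesh_pos hab (hNbar2 N)
  have hR : ∀ n, ρ n * nbar n ≤ 2 * T := fun n => by
    simpa [hρ n] using mesh_mul_le hT (hnbar2 n)
  -- Passing to the complement uses subadditivity only, as `dhat` need not be measurable.
  suffices hne : Tendsto (fun p : ℕ × ℕ => P {ω | dhat p.1 p.2 ω ≠ d}) (atTop ×ˢ atTop) (𝓝 0) by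
    have hlow : Tendsto (fun p : ℕ × ℕ => 1 - P {ω | dhat p.1 p.2 ω ≠ d})
        (atTop ×ˢ atTop) (𝓝 1) := by
      simpa using ENNReal.Tendsto.sub tendsto_const_nhds hne (Or.inl ENNReal.one_ne_top)
    refine tendsto_of_tendsto_of_tendsto_of_le_of_le hlow tendsto_const_nhds (fun p => ?_)
      fun p => prob_le_one
    rw [tsub_le_iff_right, ← measure_univ (μ := P)]
    refine (measure_mono fun ω _ => ?_).trans (measure_union_le _ _)
    exact em (dhat p.1 p.2 ω = d)
  rw [ENNReal.tendsto_nhds_zero]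
  intro η hη
  have hη3 : 0 < η / 3 := ENNReal.div_pos hη.ne' (by norm_num)
  have hZmeas : ∀ k t, Measurable (Z k t) := fun k t =>
    ((hD1.semimartingale k).adapted t).mono (𝓕.le t) le_rfl
  -- The entries of `Σ_Z` are limits in probability of measurable Riemann sums.
  have hSmeas : ∀ k l, AEMeasurable (fun ω => sigmaZ Z ω k l) P := fun k l =>
    (hD1.tendsto k l).aemeasurable fun n => (Measurable.const_mul
      (Finset.measurable_sum _ fun i _ => (hZmeas _ _).mul (hZmeas _ _)) _).aemeasurable
  obtain ⟨c, hc, hcP⟩ := exists_measure_quadForm_lt_le P hSmeas hD1.posDef hη3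
  obtain ⟨c', hc', hcΛ⟩ := exists_pos_le_quadForm hD2.posDef
  have hd0 : (0 : ℝ) < d := by exact_mod_cast hd
  -- Gram matrices of factors and loadings
  set κ : ℝ := c / (2 * d) with hκ
  have hκpos : 0 < κ := by positivity
  have hdκ : c - d * κ = c / 2 := by rw [hκ]; field_simp; ring
  set κ' : ℝ := c' / (2 * d) with hκ'
  have hκ'pos : 0 < κ' := by positivity
  have hdκ' : c' - d * κ' = c' / 2 := by rw [hκ']; field_simp; ring
  have hclose : ∀ᶠ n in atTop, ∑ k, ∑ l,
      P {ω | κ ≤ ‖ρ n * ∑ i, Z k (tm n i) ω * Z l (tm n i) ω - sigmaZ Z ω k l‖} ≤ η / 3 := by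
    refine ENNReal.tendsto_nhds_zero.1 ?_ _ hη3
    have := tendsto_finsetSum Finset.univ fun k _ => tendsto_finsetSum Finset.univ fun l _ =>
      tendstoInMeasure_iff_norm.1 (hD1.tendsto k l) κ hκpos
    simpa using this
  have hload : ∀ᶠ N in atTop, hsNorm (δ N • (∑ j, Matrix.of fun k l =>
      (lam k : Set.Icc a b → ℝ) (xs N j) * (lam l : Set.Icc a b → ℝ) (xs N j))
        - sigmaLambda (fun k => (lam k : Set.Icc a b → ℝ))) < κ' :=
    hD2.tendsto.eventually_lt_const hκ'pos
  have hnoise := ENNReal.tendsto_nhds_zero.1 (hD3.tendsto_measure_gram_ge hδpos hρpos hR hCq) _ hη3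
  have hqsmall := hq.eventually_lt_const
    (show (0 : ℝ) < c / 2 * (c' / 2) / 4 by positivity)
  filter_upwards [hnoise, hqsmall, hCq.eventually_gt_atTop 0,
    tendsto_fst.eventually hclose, tendsto_snd.eventually hload,
    tendsto_fst.eventually (hnbar.eventually_gt_atTop kmax),
    tendsto_snd.eventually (hNbar.eventually_gt_atTop kmax)]
    with ⟨n, N⟩ hnoise hqsmall hqpos hclose hload hn hN
  simp only at hnoise hqsmall hqpos hclose hload hn hN ⊢
  have hqpos : 0 < q n N := pos_of_mul_pos_right hqpos
    (le_min (Real.rpow_nonneg (hδpos N).le _) (Real.rpow_nonneg (hρpos n).le _))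
  -- Three bad events, each of probability at most `η/3`: `Σ_Z` nearly degenerate, the empirical
  -- Gram matrix of the factors far from `Σ_Z`, and noise above the penalty.
  set E₁ := {ω | ¬ ∀ w : Fin d → ℝ, c * (w ⬝ᵥ w) ≤ w ⬝ᵥ (sigmaZ Z ω *ᵥ w)} with hE₁
  set E₂ := ⋃ k, ⋃ l, {ω | κ ≤ ‖ρ n * ∑ i, Z k (tm n i) ω * Z l (tm n i) ω - sigmaZ Z ω k l‖}
    with hE₂
  set E₃ := {ω | q n N ^ 2 ≤ ∑ i, ∑ j,
    (ρ n * δ N * ∑ l, ε (tm n i) (xs N l) ω * ε (tm n j) (xs N l) ω) ^ 2} with hE₃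
  have hE₂le : P E₂ ≤ η / 3 := (measure_iUnion_fintype_le _ _).trans
    ((Finset.sum_le_sum fun k _ => measure_iUnion_fintype_le _ _).trans hclose)
  -- One null set must serve all candidate `k`, since `dhat` is random; both grids now have more
  -- than `kmax` points.
  have hest : ∀ᵐ ω ∂P, ∀ k ∈ Finset.Icc 1 kmax,
      IsFactorEstimator (ρ n) (dataMatrix X φ (tm n) (xs N) ω) (Yhat n N k ω) := by
    rw [ae_all_iff]
    intro k
    by_cases hk : k ∈ Finset.Icc 1 kmax
    · have hk' := Finset.mem_Icc.1 hk
      filter_upwards [hYhat n N k hk'.1 hk'.2 (lt_min (hk'.2.trans_lt hn) (hk'.2.trans_lt hN))]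
        with ω hω _ using hω
    · exact Eventually.of_forall fun ω h => absurd h hk
  set Λ : Matrix (Fin (Nbar N)) (Fin d) ℝ :=
    Matrix.of fun j k => (lam k : Set.Icc a b → ℝ) (xs N j) with hΛdef
  have hΛ : ∀ w : Fin d → ℝ, c' / 2 * (w ⬝ᵥ w) ≤ δ N * ((Λ *ᵥ w) ⬝ᵥ (Λ *ᵥ w)) := by
    intro w
    have hΛΛ : Λᵀ * Λ = ∑ j, Matrix.of fun k l =>
        (lam k : Set.Icc a b → ℝ) (xs N j) * (lam l : Set.Icc a b → ℝ) (xs N j) := by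
      ext k l
      simp [hΛdef, Matrix.mul_apply, Matrix.sum_apply]
    rw [smul_mulVec_dotProduct_self, ← hdκ', hΛΛ]
    exact quadForm_lower_bound_of_close hκ'pos.le
      (fun k l => (abs_le_hsNorm _ k l).trans hload.le) hcΛ w
  have hsub : {ω | dhat n N ω ≠ d} ≤ᵐ[P] (E₁ ∪ E₂ ∪ E₃ : Set Ω) := by
    filter_upwards [hr, hest, hdhat n N] with ω hrω hestω hdω hned
    by_contra hgood
    have hgood : ω ∉ E₁ ∪ E₂ ∪ E₃ := hgood
    simp only [Set.mem_union, not_or] at hgood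
    obtain ⟨⟨h₁, h₂⟩, h₃⟩ := hgood
    have h₁ : ∀ w : Fin d → ℝ, c * (w ⬝ᵥ w) ≤ w ⬝ᵥ (sigmaZ Z ω *ᵥ w) := not_not.1 h₁
    have h₂ : ∀ k l, ‖ρ n * ∑ i, Z k (tm n i) ω * Z l (tm n i) ω - sigmaZ Z ω k l‖ < κ := by
      intro k l
      by_contra hkl
      exact h₂ (Set.mem_iUnion₂.2 ⟨k, l, not_lt.1 hkl⟩)
    have h₃ : ∑ i, ∑ j, (ρ n * δ N * ∑ l, ε (tm n i) (xs N l) ω * ε (tm n j) (xs N l) ω) ^ 2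
        < q n N ^ 2 := not_le.1 h₃
    set F : Matrix (Fin (nbar n)) (Fin d) ℝ := Matrix.of fun i k => Z k (tm n i) ω with hFdef
    set e : Matrix (Fin (nbar n)) (Fin (Nbar N)) ℝ :=
      Matrix.of fun i j => ε (tm n i) (xs N j) ω with hedef
    have hF : ∀ w : Fin d → ℝ, c / 2 * (w ⬝ᵥ w) ≤ ρ n * ((F *ᵥ w) ⬝ᵥ (F *ᵥ w)) := by
      intro w
      rw [smul_mulVec_dotProduct_self, ← hdκ]
      refine quadForm_lower_bound_of_close hκpos.le (fun k l => ?_) h₁ w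
      simpa [hFdef, Matrix.mul_apply] using (h₂ k l).le
    have hdata : dataMatrix X φ (tm n) (xs N) ω = F * Λᵀ + e := by
      ext i j
      simp only [dataMatrix, hX, hrω, Matrix.of_apply, Matrix.add_apply, Matrix.mul_apply,
        Matrix.transpose_apply, hFdef, hedef, hΛdef]
      ring
    have hgram : ∑ i, ∑ j, (ρ n * δ N * (e * eᵀ) i j) ^ 2 < q n N ^ 2 := by
      simpa [hedef, Matrix.mul_apply] using h₃
    have hdmem : d ∈ Finset.Icc 1 kmax := Finset.mem_Icc.2 ⟨hd, hkmax⟩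
    -- Here `B` is the Hilbert–Schmidt norm itself, the square root of the sum in `hgram`, and is
    -- thus below `q`.
    exact hned (eq_of_PC_le (hρpos n) (hδpos N) (Real.sqrt_nonneg _)
      (Real.sq_sqrt (by positivity)).ge hdata (half_pos hc) (half_pos hc') hF hΛ
      ((Real.sqrt_lt' hqpos).2 hgram) (by linarith)
      ((Finset.mem_Icc.1 hdω.1).2.trans_lt hn) (hkmax.trans_lt hn)
      (hestω _ hdω.1) (hestω d hdmem) (hdω.2 d hdmem))
  calc P {ω | dhat n N ω ≠ d} ≤ P (E₁ ∪ E₂ ∪ E₃) := measure_mono_ae hsub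
    _ ≤ P E₁ + P E₂ + P E₃ :=
        (measure_union_le _ _).trans (add_le_add_left (measure_union_le _ _) _)
    _ ≤ η / 3 + η / 3 + η / 3 := add_le_add (add_le_add hcP hE₂le) hnoise
    _ = η := ENNReal.add_thirds η
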